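/- Let $m,h\ge 1$ be integers and let $\lambda=(\lambda_1\ge\dots\ge\lambda_m\ge0)$ be a nonzero partition with at most $m$ parts that is reduced by translation, i.e. $\lambda_m=0$. Write $|\mu|=\sum_i\mu_i$. For a partition $\mu\supseteq\lambda$ with at most $m$ parts let $b_{h,\lambda\mu}$ be the number of fillings of the skew shape $\mu/\lambda$ that increase strictly along each row and down each column and whose entries in row $r$ lie in $\{1,\dots,h(r-1)\}$, let $A(h,\lambda)=\{\mu : b_{h,\lambda\mu}\ne0\}$, and let $$G_{h,\lambda}(x_1,\dots,x_m)=\sum_{\mu\in A(h,\lambda)}(-1)^{|\mu/\lambda|}\,b_{h,\lambda\mu}\,s_\mu(x_1,\dots,x_m)$$ be the inflated symmetric Grothendieck polynomial, where $s_\mu$ is the Schur polynomial. Let $\mathrm{Newt}(f)\subset\mathbb R^m$ denote the convex hull of the exponent vectors of $f$. Let $N$ be defined by $\deg G_{h,\lambda}=|\lambda|+N$. Put $\lambda^{(0)}=\lambda$, and for $1\le k\le N$ let $\lambda^{(k)}$ be obtained from $\lambda^{(k-1)}$ by adding a box to row $r_k$, where $r_k$ is the smallest $r\in[m]$ such that $\lambda^{(k-1)}_r-\lambda_r<h(r-1)$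 and adding a box to row $r$ of $\lambda^{(k-1)}$ gives a partition. Write $\lambda^{(N)}=(\lambda_1+a_1,\dots,\lambda_m+a_m)$ and $b_k=a_1+\dots+a_k$ for $1\le k\le m$. An inequality $\langle a,x\rangle\le c$ is called facet-defining for a polytope $P$ if it holds on $P$ and $P\cap\{\langle a,x\rangle=c\}$ is nonempty of dimension $\dim P-1$. Then, up to multiplication by positive scalars, the facet-defining inequalities of $\mathrm{Newt}(G_{h,\lambda})$ are exactly the following: (a) $\sum_{i=1}^m x_i\ge|\lambda|$; (b) $\sum_{i=1}^m x_i\le|\lambda|+N$, if the $S_m$-orbit of $\lambda^{(N)}$ is nontrivial (has more than one element); (c) $\sum_{i\in I}x_i\le\sum_{i=1}^{|I|}\lambda_i^{(b_k)}$, for $1\le k\le m$ and nonempty proper subsets $I\subset[m]$ with $|I|\le k$, whenever this inequality is facet-defining for $\mathrm{Newt}(s_{\lambda^{(b_k)}})$; (d) $\sum_{i\notin I}x_i\ge\sum_{i=|I|+1}^{m}\lambda_i^{(b_k)}$, for $1\le k\le m$ and proper subsets $I\subset[m]$ with $|I|\ge k$ and $|I|\ge2$, whenever this inequality is facet-defining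 for $\mathrm{Newt}(s_{\lambda^{(b_k)}})$. -/

import Mathlib

open Finset

noncomputable section

/-- The boxes `(i, j)` of the skew diagram `μ / lam`, with rows `i : Fin m` and columns `j` both
numbered from `0`. A partition with at most `m` parts is an antitone function `Fin m → ℕ`.
The Young diagram of `μ` itself is the case `lam = 0`. -/
abbrev SkewCell {m : ℕ} (lam μ : Fin m → ℕ) : Type :=
  {c : Σ i : Fin m, Fin (μ i) // lam c.1 ≤ c.2.val}

namespace SkewCell

variable {m : ℕ} {lam μ : Fin m → ℕ}

/-- The row of a box, numbered from `0`. -/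
def row (c : SkewCell lam μ) : Fin m := c.1.1

/-- The column of a box, numbered from `0`. -/
def col (c : SkewCell lam μ) : ℕ := c.1.2.val

end SkewCell

/-- Semistandard fillings of the Young diagram of `μ` with entries in the `m`-element alphabet
`Fin m`: weakly increasing along rows, strictly increasing down columns. -/
def IsSemistandard {m : ℕ} (μ : Fin m → ℕ) (T : SkewCell 0 μ → Fin m) : Prop :=
  (∀ c d, c.row = d.row → c.col < d.col → T c ≤ T d) ∧
  (∀ c d, c.col = d.col → c.row < d.row → T c < T d)

open Classical in
/-- The Schur polynomial `s_μ(x_1, …, x_m)`. -/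
def schurPoly {m : ℕ} (μ : Fin m → ℕ) : MvPolynomial (Fin m) ℂ :=
  ∑ T ∈ (univ : Finset (SkewCell 0 μ → Fin m)).filter (IsSemistandard μ),
    ∏ c, MvPolynomial.X (T c)

/-- Fillings of `μ / lam` that increase strictly along each row and down each column. -/
def IsIncreasing {m : ℕ} (lam μ : Fin m → ℕ) (f : SkewCell lam μ → ℕ) : Prop :=
  (∀ c d, c.row = d.row → c.col < d.col → f c < f d) ∧
  (∀ c d, c.col = d.col → c.row < d.row → f c < f d)

open Classical in
/-- The number `b_{h, lam μ}` of row- and column-strict fillings of `μ / lam` whose entries in the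
`r`-th row (numbered from `1`, so `r = i + 1`) lie in `{1, …, h (r - 1)}`. -/
def inflatedCount {m : ℕ} (h : ℕ) (lam μ : Fin m → ℕ) : ℕ :=
  ((Fintype.piFinset fun c : SkewCell lam μ => Icc 1 (h * c.row.val)).filter
    (IsIncreasing lam μ)).card

/-- The set `A(h, lam)` of partitions `μ ⊇ lam` with at most `m` parts and `b_{h, lam μ} ≠ 0`. -/
def inflatedSupport {m : ℕ} (h : ℕ) (lam : Fin m → ℕ) : Set (Fin m → ℕ) :=
  {μ | Antitone μ ∧ lam ≤ μ ∧ inflatedCount h lam μ ≠ 0}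

theorem inflatedSupport_finite {m : ℕ} (h : ℕ) (lam : Fin m → ℕ) :
    (inflatedSupport h lam).Finite := by
  classical
  refine Set.Finite.subset (Set.finite_Icc lam (fun i => lam i + h * i.val)) ?_
  rintro μ ⟨-, hle, hne⟩
  refine ⟨hle, fun i => ?_⟩
  obtain ⟨f, hf⟩ := Finset.card_ne_zero.mp hne
  rw [Finset.mem_filter, Fintype.mem_piFinset] at hf
  obtain ⟨hf, hinc, -⟩ := hf
  have hμ := hle i
  let cell : Fin (μ i - lam i) → SkewCell lam μ := fun j =>
    ⟨⟨i, ⟨lam i + j.val, by have := j.2; omega⟩⟩, by simp⟩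
  have hmono : StrictMono (fun j => f (cell j)) := fun j j' hj =>
    hinc _ _ rfl (Nat.add_lt_add_left hj _)
  have hcard := Finset.card_le_card_of_injOn (s := (univ : Finset (Fin (μ i - lam i))))
    (t := Icc 1 (h * i.val)) (fun j => f (cell j)) (fun j _ => hf (cell j))
    hmono.injective.injOn
  simp only [Finset.card_univ, Fintype.card_fin, Nat.card_Icc] at hcard
  show μ i ≤ lam i + h * i.val
  omega

/-- The inflated symmetric Grothendieck polynomial `G_{h, lam}(x_1, …, x_m)`. -/
def inflatedGrothendieck {m : ℕ} (h : ℕ) (lam : Fin m → ℕ) : MvPolynomial (Fin m) ℂ :=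
  ∑ μ ∈ (inflatedSupport_finite h lam).toFinset,
    ((-1) ^ (Fintype.card (SkewCell lam μ)) * (inflatedCount h lam μ : ℂ)) • schurPoly μ

/-- The Newton polytope of a polynomial: the convex hull of its exponent vectors. -/
def newtonPolytope {m : ℕ} (p : MvPolynomial (Fin m) ℂ) : Set (Fin m → ℝ) :=
  convexHull ℝ ((fun (α : Fin m →₀ ℕ) (i : Fin m) => (α i : ℝ)) '' (p.support : Set (Fin m →₀ ℕ)))

/-- A box may be added to row `r` of `ν`: fewer than `h (r - 1)` boxes (rows numbered from `1`) were
added to that row of `lam` so far, and the result is again a partition. -/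
def Addable {m : ℕ} (h : ℕ) (lam ν : Fin m → ℕ) (r : Fin m) : Prop :=
  ν r < lam r + h * r.val ∧ Antitone (Function.update ν r (ν r + 1))

open Classical in
/-- The sequence of dominating partitions `lam^(0), lam^(1), …`: at each step a box is added to the
first row that admits one. Once no row admits a box (after the index `N` with
`deg G_{h, lam} = |lam| + N`) the sequence is continued constantly. -/
def domSeq {m : ℕ} (h : ℕ) (lam : Fin m → ℕ) : ℕ → Fin m → ℕ
  | 0 => lam
  | k + 1 =>
    if H : (univ.filter (Addable h lam (domSeq h lam k))).Nonempty then
      Function.update (domSeq h lam k) ((univ.filter (Addable h lam (domSeq h lam k))).min' H)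
        (domSeq h lam k ((univ.filter (Addable h lam (domSeq h lam k))).min' H) + 1)
    else domSeq h lam k

/-- `b_k = a_1 + ⋯ + a_k`, where `lam^(N) = (lam_1 + a_1, …, lam_m + a_m)`. -/
def boxSum {m : ℕ} (h : ℕ) (lam : Fin m → ℕ) (N k : ℕ) : ℕ :=
  ∑ i : Fin m with i.val < k, (domSeq h lam N i - lam i)

/-- The dimension of the affine span of a set. -/
def affDim {m : ℕ} (S : Set (Fin m → ℝ)) : ℕ := Module.finrank ℝ (vectorSpan ℝ S)

/-- The inequality `∑ a_i x_i ≤ c` is facet-defining for `P`: it is valid on `P`, and it holds with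
equality exactly on a (nonempty) face of codimension one in `P`. -/
def IsFacetIneq {m : ℕ} (P : Set (Fin m → ℝ)) (a : Fin m → ℝ) (c : ℝ) : Prop :=
  (∀ x ∈ P, ∑ i, a i * x i ≤ c) ∧
  (P ∩ {x | ∑ i, a i * x i = c}).Nonempty ∧
  affDim (P ∩ {x | ∑ i, a i * x i = c}) + 1 = affDim P

/-- The 0/1 indicator vector of a set of coordinates. -/
def indVec {m : ℕ} (I : Finset (Fin m)) : Fin m → ℝ := fun i => if i ∈ I then 1 else 0

/-- The sum of the first `r` parts of `μ`. -/
def headSum {m : ℕ} (μ : Fin m → ℕ) (r : ℕ) : ℕ := ∑ i : Fin m with i.val < r, μ i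

/-- The sum of the parts of `μ` after the first `r`. -/
def tailSum {m : ℕ} (μ : Fin m → ℕ) (r : ℕ) : ℕ := ∑ i : Fin m with r ≤ i.val, μ i

end

/-! A filling counted by $b_{h,\lambda\mu}$ exists exactly when $\lambda\subseteq\mu$ and
$\mu_i\le\lambda_i+hi$ (rows from $0$), so $A(h,\lambda)$ is the interval of partitions between
$\lambda$ and a largest one, $\tau_i=\min_{j\le i}(\lambda_j+hj)$, called `topPart`. The sign of a
Schur polynomial in $G$ depends only on its degree, so nothing cancels, and the exponent vectors of
$G$ are the union of the weights of all $s_\mu$ with $\lambda\subseteq\mu\subseteq\tau$. The greedy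
sequence fills the rows one after the other, so $\lambda^{(b_k)}$ is $\tau$ on the first $k$ rows
and $\lambda$ below (`midPart`).

Three facts about the weights $x$ of $s_\mu$ carry the upper and lower bounds and the comparison of
faces: $\sum x_i=|\mu|$; the sum over $I$ is at most that of the first $|I|$ parts; every
rearrangement of $\mu$ is a weight. Facets are recognised dually: `constFun S` is the space of
functionals constant on $S$, and its dimension is complementary to `affDim S`. The set of exponents
of $G$ is full-dimensional, so a valid, attained inequality with nonzero normal is a facet iff every
functional constant on its face is a multiple of the normal.

Normals (`exists_normal_of_isFacetIneq`): order the coordinates so that the normal $a$ decreases. On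
the face, $x$ is a weight of a $\mu$ equal to $\tau$ where $a>0$ and to $\lambda$ where $a<0$, and
at every drop of $a$ the leading coordinates attain the head sum of $\mu$. Hence at a drop either
the sum over the leading set $I$ or the sum over $I^c$ is constant on the face, which forces $a$ to
be a multiple of $1_I$ or $-1_{I^c}$; without a drop, $a$ is a multiple of $\pm1$.

Which of these occur: the faces of $\mathrm{Newt}(s_{\lambda^{(b_k)}})$ for $k\ge|I|$ (heads) or
$k\le|I|$ (tails) all lie in one face of $\mathrm{Newt}(G)$. If one of them is a facet, the
functionals left over are $s\cdot1+t\cdot1_I$, and two shapes of different size on the same face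
remove one more dimension. Conversely, if the necessary non-constancy fails, a coordinate or the
total degree is constant on the face, giving a functional that is not a multiple of the normal. -/

noncomputable section

/-! ### Counting boxes of skew diagrams. -/

namespace SkewCell

variable {m : ℕ} {lam μ : Fin m → ℕ}

theorem col_lt (c : SkewCell lam μ) : c.col < μ c.row := c.1.2.isLt

theorem ext_row_col {c d : SkewCell lam μ} (hr : c.row = d.row) (hc : c.col = d.col) : c = d := by
  obtain ⟨⟨i, j⟩, hj⟩ := c
  obtain ⟨⟨i', j'⟩, hj'⟩ := d
  obtain rfl : i = i' := hr
  obtain rfl : j = j' := Fin.ext hc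
  rfl

/-- The box of the Young diagram of `μ` in row `i` and column `j`. -/
def mk (i : Fin m) (j : ℕ) (hj : j < μ i) : SkewCell (0 : Fin m → ℕ) μ :=
  ⟨⟨i, ⟨j, hj⟩⟩, Nat.zero_le _⟩

@[simp] theorem row_mk (i : Fin m) (j : ℕ) (hj : j < μ i) : (mk i j hj).row = i := rfl

@[simp] theorem col_mk (i : Fin m) (j : ℕ) (hj : j < μ i) : (mk i j hj).col = j := rfl

theorem card_row_lt (μ : Fin m → ℕ) (r : ℕ) :
    (univ.filter fun c : SkewCell (0 : Fin m → ℕ) μ => c.row.val < r).card = headSum μ r := by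
  classical
  rw [headSum]
  have : ∑ i : Fin m with i.val < r, μ i
      = ((univ.filter fun i : Fin m => i.val < r).sigma fun i => (univ : Finset (Fin (μ i)))).card := by
    simp
  rw [this]
  refine Finset.card_bij (fun c _ => c.1) ?_ ?_ ?_
  · intro c hc
    simp only [mem_filter, mem_univ, true_and, mem_sigma, and_true] at hc ⊢
    exact hc
  · intro c _ d _ h
    exact Subtype.ext h
  · intro b hb
    refine ⟨⟨b, Nat.zero_le _⟩, ?_, rfl⟩
    simp only [mem_filter, mem_univ, true_and, mem_sigma, and_true] at hb ⊢
    exact hb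

theorem card_eq_sum (μ : Fin m → ℕ) :
    Fintype.card (SkewCell (0 : Fin m → ℕ) μ) = ∑ i, μ i := by
  have h := card_row_lt μ m
  simpa [headSum] using h

theorem card_add_sum (h : lam ≤ μ) :
    Fintype.card (SkewCell lam μ) + ∑ i, lam i = ∑ i, μ i := by
  classical
  have e : Fintype.card (SkewCell lam μ)
      = (univ.sigma fun i => (univ : Finset (Fin (μ i))).filter fun j => lam i ≤ j.val).card := by
    rw [Fintype.card_subtype]
    congr 1
    ext c
    simp
  rw [e, Finset.card_sigma, ← Finset.sum_add_distrib]
  refine Finset.sum_congr rfl fun i _ => ?_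
  have h1 := Finset.card_filter_add_card_filter_not (s := (univ : Finset (Fin (μ i))))
    (fun j => lam i ≤ j.val)
  have h2 : ((univ : Finset (Fin (μ i))).filter fun j => ¬ lam i ≤ j.val).card = lam i := by
    simp only [not_le]
    rw [Fin.card_filter_val_lt]
    exact min_eq_right (h i)
  rw [h2] at h1
  simpa using h1

end SkewCell

/-- The content of a filling: how often each letter occurs. -/
def content {m : ℕ} {μ : Fin m → ℕ} (T : SkewCell 0 μ → Fin m) : Fin m →₀ ℕ :=
  ∑ c, Finsupp.single (T c) 1

/-! ### Contents of semistandard tableaux and their upper bounds. -/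

section content

variable {m : ℕ} {μ : Fin m → ℕ}

theorem content_apply (T : SkewCell 0 μ → Fin m) (i : Fin m) :
    content T i = (univ.filter fun c => T c = i).card := by
  rw [content, Finsupp.finsetSum_apply, Finset.card_filter]
  simp only [Finsupp.single_apply]

theorem sum_content (T : SkewCell 0 μ → Fin m) (I : Finset (Fin m)) :
    ∑ i ∈ I, content T i = (univ.filter fun c => T c ∈ I).card := by
  classical
  rw [Finset.card_eq_sum_card_fiberwise (f := T) (t := I) (fun c hc => by simpa using hc)]
  refine Finset.sum_congr rfl fun i hi => ?_
  rw [content_apply]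
  congr 1
  ext c
  simp only [mem_filter, mem_univ, true_and]
  exact ⟨fun h => ⟨h ▸ hi, h⟩, fun h => h.2⟩

theorem sum_univ_content (T : SkewCell 0 μ → Fin m) : ∑ i, content T i = ∑ i, μ i := by
  rw [sum_content, ← SkewCell.card_eq_sum]
  simp

/-- Column by column: the letters of a column are distinct, so those from `I` number at most the
minimum of `I.card` and the column length, which is the number of boxes of that column in the first
`I.card` rows. -/
theorem sum_content_le_headSum (hμ : Antitone μ) {T : SkewCell 0 μ → Fin m}
    (hT : IsSemistandard μ T) (I : Finset (Fin m)) :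
    ∑ i ∈ I, content T i ≤ headSum μ I.card := by
  classical
  rw [sum_content, ← SkewCell.card_row_lt]
  set J := Finset.univ.image (fun c : SkewCell (0 : Fin m → ℕ) μ => c.col)
  rw [Finset.card_eq_sum_card_fiberwise (f := SkewCell.col) (t := J) (fun c _ => by simp [J]),
    Finset.card_eq_sum_card_fiberwise (f := SkewCell.col) (t := J) (fun c _ => by simp [J])]
  refine Finset.sum_le_sum fun j _ => ?_
  -- Either column `j` reaches below the first `I.card` rows, and so has a box in each of them, or
  -- all its boxes lie in those rows.
  by_cases hj : ∃ i : Fin m, I.card ≤ i.val ∧ j < μ i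
  · obtain ⟨i, hi, hji⟩ := hj
    have h1 : ((univ.filter fun c => T c ∈ I).filter fun c => c.col = j).card ≤ I.card := by
      refine Finset.card_le_card_of_injOn T (fun c hc => ?_) ?_
      · simp only [coe_filter, mem_filter, mem_univ, true_and, Set.mem_ofPred_eq] at hc
        exact hc.1
      · intro c hc d hd hcd
        simp only [coe_filter, mem_filter, mem_univ, true_and, Set.mem_ofPred_eq] at hc hd
        have e := hc.2.trans hd.2.symm
        rcases lt_trichotomy c.row d.row with h | h | h
        · exact absurd hcd (hT.2 c d e h).ne
        · exact SkewCell.ext_row_col h e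
        · exact absurd hcd (hT.2 d c e.symm h).ne'
    refine h1.trans ?_
    have hle : ∀ s : Fin I.card, s.val < m := fun s => lt_of_lt_of_le s.2 (hi.trans i.2.le)
    have hmem : ∀ s : Fin I.card, j < μ ⟨s.val, hle s⟩ := fun s =>
      lt_of_lt_of_le hji (hμ (Fin.le_def.2 (s.2.le.trans hi)))
    have h2 := Finset.card_le_card_of_injOn (s := (univ : Finset (Fin I.card)))
      (t := (univ.filter fun c : SkewCell (0 : Fin m → ℕ) μ => c.row.val < I.card).filter
        fun c => c.col = j)
      (fun s => SkewCell.mk ⟨s.val, hle s⟩ j (hmem s)) (fun s _ => by simp) (by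
        intro s _ t _ hst
        have := congrArg (fun c => (SkewCell.row c).val) hst
        exact Fin.ext this)
    simpa using h2
  · push Not at hj
    refine Finset.card_le_card fun c hc => ?_
    simp only [mem_filter, mem_univ, true_and] at hc ⊢
    refine ⟨?_, hc.2⟩
    by_contra hcon
    have h1 := hj c.row (not_lt.1 hcon)
    have h2 := c.col_lt
    omega

end content

/-! ### Existence of tableaux, and the support of `G`. -/

/-- Pigeonhole: otherwise the `i + 1` smallest elements of `s` would all be among the `i` smallest
of `t`. It makes the rows of the tableau below weakly increasing. -/
theorem orderEmbOfFin_le_of_subset {α : Type*} [LinearOrder α] {s t : Finset α} (h : s ⊆ t)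
    (i : ℕ) (hs : i < s.card) (ht : i < t.card) :
    t.orderEmbOfFin rfl ⟨i, ht⟩ ≤ s.orderEmbOfFin rfl ⟨i, hs⟩ := by
  by_contra hlt
  push Not at hlt
  have key : ∀ k : Fin (i + 1), ∃ l : Fin i,
      t.orderEmbOfFin rfl ⟨l.val, l.2.trans ht⟩
        = s.orderEmbOfFin rfl ⟨k.val, (Nat.lt_succ_iff.1 k.2).trans_lt hs⟩ := by
    intro k
    have hk : s.orderEmbOfFin rfl ⟨k.val, (Nat.lt_succ_iff.1 k.2).trans_lt hs⟩ ∈ t :=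
      h (Finset.orderEmbOfFin_mem _ _ _)
    rw [← Finset.mem_coe, ← Finset.range_orderEmbOfFin t rfl] at hk
    obtain ⟨l, hl⟩ := hk
    have : l < ⟨i, ht⟩ := by
      rw [← (t.orderEmbOfFin rfl).lt_iff_lt, hl]
      refine lt_of_le_of_lt ?_ hlt
      rw [(s.orderEmbOfFin rfl).le_iff_le]
      exact Nat.lt_succ_iff.1 k.2
    exact ⟨⟨l.val, this⟩, hl⟩
  choose g hg using key
  have hinj : Function.Injective g := by
    intro a b hab
    have h1 := hg a
    rw [hab, hg b] at h1
    have h2 := (s.orderEmbOfFin rfl).injective h1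
    exact Fin.ext (by simpa using h2.symm)
  have := Fintype.card_le_of_injective g hinj
  simp at this

/-- For every rearrangement of `μ` there is a semistandard tableau of shape `μ` and that content. -/
theorem exists_semistandard_content {m : ℕ} {μ : Fin m → ℕ} (hμ : Antitone μ)
    (w : Equiv.Perm (Fin m)) :
    ∃ T : SkewCell 0 μ → Fin m, IsSemistandard μ T ∧ ∀ i, content T i = μ (w i) := by
  classical
  -- `K j` is the set of letters of column `j`: letter `l` goes into the first `μ (w l)` columns. It
  -- has the size of that column by `hK`, and it shrinks as `j` grows.
  let K : ℕ → Finset (Fin m) := fun j => univ.filter fun l => j < μ (w l)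
  have hK : ∀ j (i : Fin m), i.val < (K j).card ↔ j < μ i := by
    intro j i
    have e : (K j).card = (univ.filter fun l : Fin m => j < μ l).card := by
      refine Finset.card_bij (fun l _ => w l) (fun l hl => ?_) (fun _ _ _ _ h => w.injective h) ?_
      · simpa [K] using hl
      · intro l hl
        exact ⟨w.symm l, by simpa [K] using hl, by simp⟩
    rw [e]
    constructor
    · intro hi
      by_contra hcon
      have hsub : (univ.filter fun l : Fin m => j < μ l) ⊆ univ.filter fun l : Fin m => l.val < i.val := by
        intro l hl
        simp only [mem_filter, mem_univ, true_and] at hl ⊢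
        by_contra hl'
        have := hμ (Fin.le_def.2 (not_lt.1 hl'))
        omega
      have := Finset.card_le_card hsub
      rw [Fin.card_filter_val_lt] at this
      omega
    · intro hi
      have hsub : (univ.filter fun l : Fin m => l.val < i.val + 1) ⊆ univ.filter fun l : Fin m => j < μ l := by
        intro l hl
        simp only [mem_filter, mem_univ, true_and] at hl ⊢
        exact lt_of_lt_of_le hi (hμ (Fin.le_def.2 (Nat.lt_succ_iff.1 hl)))
      have := Finset.card_le_card hsub
      rw [Fin.card_filter_val_lt] at this
      have := i.2
      omega
  let T : SkewCell 0 μ → Fin m := fun c =>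
    (K c.col).orderEmbOfFin rfl ⟨c.row.val, (hK _ _).2 c.col_lt⟩
  refine ⟨T, ⟨?_, ?_⟩, ?_⟩
  · intro c d hr hc
    have hsub : K d.col ⊆ K c.col := by
      intro l hl
      simp only [K, mem_filter, mem_univ, true_and] at hl ⊢
      omega
    have hlt : c.row.val < (K d.col).card := by
      rw [hr]; exact (hK _ _).2 d.col_lt
    have := orderEmbOfFin_le_of_subset hsub c.row.val hlt ((hK _ _).2 c.col_lt)
    refine this.trans (le_of_eq ?_)
    simp only [T]
    congr 1
    simp only [hr]
  · intro c d hc hr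
    have aux : ∀ (s : Finset (Fin m)) (hs : s = K d.col) (hlt : c.row.val < s.card),
        s.orderEmbOfFin rfl ⟨c.row.val, hlt⟩ < T d := by
      rintro s rfl hlt
      exact ((K d.col).orderEmbOfFin rfl).lt_iff_lt.2 hr
    exact aux _ (by rw [hc]) _
  · intro l
    rw [content_apply, ← Finset.card_range (μ (w l))]
    refine Finset.card_bij (fun c _ => c.col) ?_ ?_ ?_
    · intro c hc
      simp only [mem_filter, mem_univ, true_and] at hc
      have : T c ∈ K c.col := Finset.orderEmbOfFin_mem _ _ _
      rw [hc] at this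
      simpa [K] using this
    · intro c hc d hd hcd
      simp only [mem_filter, mem_univ, true_and] at hc hd
      refine SkewCell.ext_row_col ?_ hcd
      have aux : ∀ (s : Finset (Fin m)) (hs : s = K d.col) (hlt : c.row.val < s.card),
          s.orderEmbOfFin rfl ⟨c.row.val, hlt⟩ = T d → c.row = d.row := by
        rintro s rfl hlt heq
        have := ((K d.col).orderEmbOfFin rfl).injective heq
        exact Fin.ext (by simpa using this)
      exact aux _ (by rw [hcd]) _ (hc.trans hd.symm)
    · intro j hj
      have hl : l ∈ K j := by simpa [K] using hj
      rw [← Finset.mem_coe, ← Finset.range_orderEmbOfFin (K j) rfl] at hl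
      obtain ⟨i, hi⟩ := hl
      have him : i.val < m := lt_of_lt_of_le i.2 ((Finset.card_le_univ _).trans (by simp))
      refine ⟨SkewCell.mk ⟨i.val, him⟩ j ((hK _ _).1 i.2), ?_, rfl⟩
      simp only [mem_filter, mem_univ, true_and]
      exact hi

open Classical in
theorem coeff_schurPoly {m : ℕ} (μ : Fin m → ℕ) (α : Fin m →₀ ℕ) :
    (schurPoly μ).coeff α
      = ((univ.filter fun T => IsSemistandard μ T ∧ content T = α).card : ℂ) := by
  have h : ∀ T : SkewCell 0 μ → Fin m,
      (∏ c, MvPolynomial.X (T c) : MvPolynomial (Fin m) ℂ)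
        = MvPolynomial.monomial (content T) 1 := by
    intro T
    rw [content, MvPolynomial.monomial_sum_one]
    rfl
  simp only [schurPoly, h, MvPolynomial.coeff_sum, MvPolynomial.coeff_monomial]
  rw [Finset.sum_boole, Finset.filter_filter]

theorem mem_support_schurPoly {m : ℕ} {μ : Fin m → ℕ} {α : Fin m →₀ ℕ} :
    α ∈ (schurPoly μ).support ↔ ∃ T, IsSemistandard μ T ∧ content T = α := by
  classical
  rw [MvPolynomial.mem_support_iff, coeff_schurPoly, Nat.cast_ne_zero, Finset.card_ne_zero]
  simp [Finset.Nonempty]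

theorem sum_eq_of_mem_support_schurPoly {m : ℕ} {μ : Fin m → ℕ} {α : Fin m →₀ ℕ}
    (h : α ∈ (schurPoly μ).support) : ∑ i, α i = ∑ i, μ i := by
  obtain ⟨T, -, rfl⟩ := mem_support_schurPoly.1 h
  exact sum_univ_content T

/-- A strictly increasing row has at most as many boxes as allowed entries; conversely, under these
bounds the filling with the largest possible entries works. -/
theorem mem_inflatedSupport_iff {m : ℕ} {h : ℕ} (hh : 1 ≤ h) {lam μ : Fin m → ℕ} :
    μ ∈ inflatedSupport h lam ↔ Antitone μ ∧ lam ≤ μ ∧ ∀ i, μ i ≤ lam i + h * i.val := by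
  classical
  refine and_congr_right fun hμ => and_congr_right fun hle => ?_
  constructor
  · intro hne i
    obtain ⟨f, hf⟩ := Finset.card_ne_zero.mp hne
    rw [Finset.mem_filter, Fintype.mem_piFinset] at hf
    obtain ⟨hf, hinc, -⟩ := hf
    let cell : Fin (μ i - lam i) → SkewCell lam μ := fun j =>
      ⟨⟨i, ⟨lam i + j.val, by have := j.2; omega⟩⟩, by simp⟩
    have hmono : StrictMono (fun j => f (cell j)) := fun j j' hj =>
      hinc _ _ rfl (Nat.add_lt_add_left hj _)
    have hcard := Finset.card_le_card_of_injOn (s := (univ : Finset (Fin (μ i - lam i))))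
      (t := Icc 1 (h * i.val)) (fun j => f (cell j)) (fun j _ => hf (cell j))
      hmono.injective.injOn
    simp only [Finset.card_univ, Fintype.card_fin, Nat.card_Icc] at hcard
    omega
  · intro hub
    -- Row `i` ends with its largest allowed entry `h * i` and decreases by one to the left. Down a
    -- column `h * i` grows strictly, as `1 ≤ h`, while `μ i` does not grow.
    refine Finset.card_ne_zero.2 ⟨fun c => h * c.row.val + (c.col + 1) - μ c.row, ?_⟩
    have hcol : ∀ c : SkewCell lam μ, lam c.row ≤ c.col := fun c => c.2
    rw [Finset.mem_filter, Fintype.mem_piFinset]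
    refine ⟨fun c => ?_, fun c d hr hc => ?_, fun c d hc hr => ?_⟩
    · have h1 := hcol c
      have h2 := c.col_lt
      have h3 := hub c.row
      simp only [mem_Icc]
      omega
    · have h1 := hcol c
      have h3 := hub c.row
      simp only [← hr]
      omega
    · have h1 := hcol c
      have h3 := hub c.row
      have h4 := hμ hr.le
      have h5 : h * c.row.val < h * d.row.val := Nat.mul_lt_mul_of_pos_left hr hh
      simp only [← hc]
      omega

/-- There is no cancellation between the Schur polynomials in `G_{h, lam}`. -/
theorem mem_support_inflatedGrothendieck {m : ℕ} {h : ℕ} {lam : Fin m → ℕ} {α : Fin m →₀ ℕ} :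
    α ∈ (inflatedGrothendieck h lam).support ↔
      ∃ μ ∈ inflatedSupport h lam, α ∈ (schurPoly μ).support := by
  classical
  let n : (Fin m → ℕ) → ℕ := fun μ =>
    (univ.filter fun T => IsSemistandard μ T ∧ content T = α).card
  have hn : ∀ μ, (schurPoly μ).coeff α = (n μ : ℂ) := fun μ => coeff_schurPoly μ α
  -- Every `s_μ` containing `α` has `|μ| = |α|`, so one sign common to all terms makes the
  -- coefficient a sum of natural numbers.
  have key : (inflatedGrothendieck h lam).coeff α * (-1) ^ (∑ i, lam i + ∑ i, α i)
      = ((∑ μ ∈ (inflatedSupport_finite h lam).toFinset, inflatedCount h lam μ * n μ : ℕ) : ℂ) := by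
    rw [inflatedGrothendieck, MvPolynomial.coeff_sum, Finset.sum_mul, Nat.cast_sum]
    refine Finset.sum_congr rfl fun μ hμ => ?_
    rw [MvPolynomial.coeff_smul, hn, smul_eq_mul, Nat.cast_mul]
    by_cases h0 : n μ = 0
    · simp [h0]
    · have hs : ∑ i, α i = ∑ i, μ i := sum_eq_of_mem_support_schurPoly (by
        rw [MvPolynomial.mem_support_iff, hn]; exact_mod_cast h0)
      have hle : lam ≤ μ := ((Set.Finite.mem_toFinset _).1 hμ).2.1
      rw [hs, ← SkewCell.card_add_sum hle]
      have : ((-1 : ℂ)) ^ (Fintype.card (SkewCell lam μ)) *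
          (-1) ^ (∑ i, lam i + (Fintype.card (SkewCell lam μ) + ∑ i, lam i)) = 1 := by
        rw [← pow_add]
        exact Even.neg_one_pow ⟨Fintype.card (SkewCell lam μ) + ∑ i, lam i, by ring⟩
      linear_combination (inflatedCount h lam μ : ℂ) * (n μ : ℂ) * this
  have hsgn : ((-1 : ℂ)) ^ (∑ i, lam i + ∑ i, α i) ≠ 0 := pow_ne_zero _ (by norm_num)
  rw [MvPolynomial.mem_support_iff, ← mul_ne_zero_iff_right hsgn, key, Nat.cast_ne_zero,
    Ne, Finset.sum_eq_zero_iff]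
  push Not
  refine exists_congr fun μ => ?_
  rw [Set.Finite.mem_toFinset, MvPolynomial.mem_support_iff, hn, Nat.cast_ne_zero, mul_ne_zero_iff]
  exact and_congr_right fun hμ => ⟨fun hx => hx.2, fun hx => ⟨hμ.2.2, hx⟩⟩

/-! ### Facets through the functionals constant on a face. -/

section convexity

variable {m : ℕ}

/-- The linear functionals, written as vectors, that are constant on `S`. -/
def constFun (S : Set (Fin m → ℝ)) : Submodule ℝ (Fin m → ℝ) :=
  (vectorSpan ℝ S).dualAnnihilator.comap (dotProductEquiv ℝ (Fin m)).toLinearMap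

theorem mem_constFun {S : Set (Fin m → ℝ)} {u : Fin m → ℝ} :
    u ∈ constFun S ↔ ∀ x ∈ S, ∀ y ∈ S, ∑ i, u i * x i = ∑ i, u i * y i := by
  rw [constFun, Submodule.mem_comap, Submodule.mem_dualAnnihilator, vectorSpan]
  have : ∀ x y : Fin m → ℝ,
      ((dotProductEquiv ℝ (Fin m)).toLinearMap u) (x - y) = ∑ i, u i * x i - ∑ i, u i * y i := by
    intro x y
    rw [map_sub]
    rfl
  constructor
  · intro h x hx y hy
    have h0 := h (x - y) (Submodule.subset_span ⟨x, hx, y, hy, rfl⟩)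
    exact sub_eq_zero.1 ((this x y).symm.trans h0)
  · intro h v hv
    induction hv using Submodule.span_induction with
    | mem v hv =>
      obtain ⟨x, hx, y, hy, rfl⟩ := hv
      exact (this x y).trans (sub_eq_zero.2 (h x hx y hy))
    | zero => exact map_zero _
    | add v w _ _ h1 h2 => rw [map_add, h1, h2, add_zero]
    | smul t v _ h1 => rw [map_smul, h1, smul_zero]

theorem mem_constFun_of_eq {S : Set (Fin m → ℝ)} {u : Fin m → ℝ} {c : ℝ}
    (h : ∀ x ∈ S, ∑ i, u i * x i = c) : u ∈ constFun S :=
  mem_constFun.2 fun x hx y hy => (h x hx).trans (h y hy).symm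

theorem constFun_anti {S T : Set (Fin m → ℝ)} (h : S ⊆ T) : constFun T ≤ constFun S :=
  fun _ hu => mem_constFun.2 fun x hx y hy => mem_constFun.1 hu x (h hx) y (h hy)

theorem affDim_add_finrank_constFun (S : Set (Fin m → ℝ)) :
    affDim S + Module.finrank ℝ (constFun S) = m := by
  have h1 := Subspace.finrank_add_finrank_dualAnnihilator_eq (vectorSpan ℝ S)
  have h2 : Module.finrank ℝ (constFun S)
      = Module.finrank ℝ (vectorSpan ℝ S).dualAnnihilator := by
    have h3 := Submodule.map_equiv_eq_comap_symm (dotProductEquiv ℝ (Fin m)).symm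
      (vectorSpan ℝ S).dualAnnihilator
    rw [LinearEquiv.symm_symm] at h3
    rw [constFun, ← h3]
    exact LinearEquiv.finrank_map_eq _ _
  rw [h2, affDim, h1, Module.finrank_fin_fun]

theorem affDim_convexHull (S : Set (Fin m → ℝ)) : affDim (convexHull ℝ S) = affDim S := by
  rw [affDim, affDim, ← direction_affineSpan, affineSpan_convexHull, direction_affineSpan]

/-- A convex combination attains equality in a valid inequality only if every point of nonzero
weight does. This allows facets to be tested on exponent vectors alone. -/
theorem convexHull_inter_hyperplane {V : Set (Fin m → ℝ)} {a : Fin m → ℝ} {c : ℝ}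
    (hV : ∀ x ∈ V, ∑ i, a i * x i ≤ c) :
    convexHull ℝ V ∩ {x | ∑ i, a i * x i = c} = convexHull ℝ (V ∩ {x | ∑ i, a i * x i = c}) := by
  classical
  have hlin : ∀ {ι : Type} (t : Finset ι) (w : ι → ℝ) (z : ι → Fin m → ℝ),
      ∑ i, a i * (∑ k ∈ t, w k • z k) i = ∑ k ∈ t, w k * ∑ i, a i * z k i := by
    intro ι t w z
    simp only [Finset.sum_apply, Pi.smul_apply, smul_eq_mul, Finset.mul_sum]
    rw [Finset.sum_comm]
    exact Finset.sum_congr rfl fun _ _ => Finset.sum_congr rfl fun _ _ => by ring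
  apply Set.Subset.antisymm
  · rintro x ⟨hx, hc⟩
    rw [_root_.convexHull_eq] at hx
    obtain ⟨ι, t, w, z, hw, hw1, hz, rfl⟩ := hx
    have h0 : ∑ k ∈ t, w k * (c - ∑ i, a i * z k i) = 0 := by
      have : ∑ i, a i * (t.centerMass w z) i = c := hc
      rw [Finset.centerMass_eq_of_sum_1 _ _ hw1, hlin] at this
      simp only [mul_sub, Finset.sum_sub_distrib, this, ← Finset.sum_mul, hw1, one_mul, sub_self]
    rw [Finset.sum_eq_zero_iff_of_nonneg fun k hk =>
      mul_nonneg (hw k hk) (sub_nonneg.2 (hV _ (hz k hk)))] at h0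
    rw [← Finset.centerMass_filter_ne_zero]
    refine Finset.centerMass_mem_convexHull _ (fun k hk => hw k (Finset.mem_filter.1 hk).1) ?_ ?_
    · rw [Finset.sum_filter_ne_zero, hw1]
      exact one_pos
    · intro k hk
      rw [Finset.mem_filter] at hk
      refine ⟨hz k hk.1, ?_⟩
      have := (mul_eq_zero.1 (h0 k hk.1)).resolve_left hk.2
      exact (sub_eq_zero.1 this).symm
  · refine Set.subset_inter (convexHull_mono Set.inter_subset_left) ?_
    refine convexHull_min Set.inter_subset_right ?_
    exact convex_hyperplane (IsLinearMap.mk (fun x y => by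
      simp [mul_add, Finset.sum_add_distrib]) (fun t x => by
      simp only [Pi.smul_apply, smul_eq_mul, Finset.mul_sum]
      exact Finset.sum_congr rfl fun _ _ => by ring)) c

theorem forall_convexHull_le_iff {V : Set (Fin m → ℝ)} {a : Fin m → ℝ} {c : ℝ} :
    (∀ x ∈ convexHull ℝ V, ∑ i, a i * x i ≤ c) ↔ ∀ x ∈ V, ∑ i, a i * x i ≤ c := by
  refine ⟨fun h x hx => h x (subset_convexHull ℝ V hx), fun h => ?_⟩
  exact convexHull_min h (convex_halfSpace_le (IsLinearMap.mk (fun x y => by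
      simp [mul_add, Finset.sum_add_distrib]) (fun t x => by
      simp only [Pi.smul_apply, smul_eq_mul, Finset.mul_sum]
      exact Finset.sum_congr rfl fun _ _ => by ring)) c)

theorem isFacetIneq_convexHull_iff {V : Set (Fin m → ℝ)} {a : Fin m → ℝ} {c : ℝ} :
    IsFacetIneq (convexHull ℝ V) a c ↔ IsFacetIneq V a c := by
  rw [IsFacetIneq, IsFacetIneq, forall_convexHull_le_iff]
  refine and_congr_right fun h => ?_
  rw [convexHull_inter_hyperplane h, affDim_convexHull, affDim_convexHull,
    convexHull_nonempty_iff]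

/-- Only the slack on `V` matters. The normals need not be proportional, which is used to exchange
head and tail inequalities on a set of constant coordinate sum. -/
theorem IsFacetIneq.of_sub_eq {V : Set (Fin m → ℝ)} {a a' : Fin m → ℝ} {c c' t : ℝ} (ht : 0 < t)
    (h : ∀ x ∈ V, ∑ i, a' i * x i - c' = t * (∑ i, a i * x i - c)) (hf : IsFacetIneq V a c) :
    IsFacetIneq V a' c' := by
  have hset : V ∩ {x | ∑ i, a' i * x i = c'} = V ∩ {x | ∑ i, a i * x i = c} := by
    ext x
    refine and_congr_right fun hx => ?_
    have := h x hx
    simp only [Set.mem_ofPred_eq]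
    rw [← sub_eq_zero, this, mul_eq_zero, sub_eq_zero]
    simp [ht.ne']
  refine ⟨fun x hx => ?_, hset ▸ hf.2.1, hset ▸ hf.2.2⟩
  have h1 := h x hx
  have h2 := hf.1 x hx
  nlinarith

theorem IsFacetIneq.smul {V : Set (Fin m → ℝ)} {a : Fin m → ℝ} {c t : ℝ} (ht : 0 < t)
    (hf : IsFacetIneq V a c) : IsFacetIneq V (t • a) (t * c) := by
  refine hf.of_sub_eq ht fun x _ => ?_
  rw [mul_sub, Finset.mul_sum]
  congr 1
  exact Finset.sum_congr rfl fun i _ => by rw [Pi.smul_apply, smul_eq_mul, mul_assoc]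

theorem IsFacetIneq.eq_rhs {V : Set (Fin m → ℝ)} {a : Fin m → ℝ} {c c' : ℝ}
    (hf : IsFacetIneq V a c) (h : ∀ x ∈ V, ∑ i, a i * x i ≤ c')
    (h' : ∃ x ∈ V, ∑ i, a i * x i = c') : c = c' := by
  obtain ⟨x, hx, hxc⟩ := h'
  obtain ⟨y, hy, hyc⟩ := hf.2.1
  refine le_antisymm ?_ (hxc ▸ hf.1 x hx)
  rw [← show ∑ i, a i * y i = c from hyc]
  exact h y hy

/-- Facets in terms of the functionals that are constant on the face. -/
theorem isFacetIneq_iff_finrank_constFun {V : Set (Fin m → ℝ)} {a : Fin m → ℝ} {c : ℝ} :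
    IsFacetIneq V a c ↔ (∀ x ∈ V, ∑ i, a i * x i ≤ c) ∧ (∃ x ∈ V, ∑ i, a i * x i = c) ∧
      Module.finrank ℝ (constFun (V ∩ {x | ∑ i, a i * x i = c}))
        = Module.finrank ℝ (constFun V) + 1 := by
  have h1 := affDim_add_finrank_constFun (V ∩ {x | ∑ i, a i * x i = c})
  have h2 := affDim_add_finrank_constFun V
  refine and_congr_right fun _ => and_congr Iff.rfl ?_
  omega

theorem mem_constFun_face (V : Set (Fin m → ℝ)) (a : Fin m → ℝ) (c : ℝ) :
    a ∈ constFun (V ∩ {x | ∑ i, a i * x i = c}) :=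
  mem_constFun_of_eq (c := c) fun _ hx => hx.2

/-- Facets of a full-dimensional set. -/
theorem isFacetIneq_iff_of_constFun_eq_bot {V : Set (Fin m → ℝ)} (hV : constFun V = ⊥)
    {a : Fin m → ℝ} {c : ℝ} :
    IsFacetIneq V a c ↔ (∀ x ∈ V, ∑ i, a i * x i ≤ c) ∧ (∃ x ∈ V, ∑ i, a i * x i = c) ∧
      a ≠ 0 ∧ ∀ u ∈ constFun (V ∩ {x | ∑ i, a i * x i = c}), ∃ t : ℝ, u = t • a := by
  rw [isFacetIneq_iff_finrank_constFun, hV, finrank_bot, zero_add]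
  refine and_congr_right fun _ => and_congr_right fun _ => ?_
  have ha := mem_constFun_face V a c
  set C := constFun (V ∩ {x | ∑ i, a i * x i = c}) with hC
  constructor
  · intro h1
    have hne : a ≠ 0 := by
      rintro rfl
      -- For `a = 0` the face is all of `V` or empty; the first contradicts the dimension, the
      -- second the attained equality.
      have : C = constFun V ∨ c ≠ 0 := by
        by_cases hc : c = 0
        · left; rw [hC, hc]; simp
        · exact Or.inr hc
      rcases this with h | h
      · rw [h, hV, finrank_bot] at h1
        omega
      · obtain ⟨x, _, hx⟩ := ‹∃ x ∈ V, _›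
        simp at hx
        exact h hx.symm
    refine ⟨hne, fun u hu => ?_⟩
    obtain ⟨t, ht⟩ := exists_smul_eq_of_finrank_eq_one h1
      (x := (⟨a, ha⟩ : C)) (fun h => hne (congrArg Subtype.val h)) ⟨u, hu⟩
    exact ⟨t, (congrArg Subtype.val ht).symm⟩
  · rintro ⟨hne, h⟩
    refine finrank_eq_one (⟨a, ha⟩ : C) (fun h => hne (congrArg Subtype.val h)) fun u => ?_
    obtain ⟨t, ht⟩ := h u.1 u.2
    exact ⟨t, Subtype.ext ht.symm⟩

/-- Abel summation for an antitone weight. -/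
theorem sum_mul_ge_of_partial_sums_nonneg {d x : ℕ → ℝ} (hd : Antitone d)
    (hx : ∀ r, 0 ≤ ∑ i ∈ range r, x i) (n : ℕ) :
    d n * ∑ i ∈ range (n + 1), x i ≤ ∑ i ∈ range (n + 1), d i * x i := by
  induction n with
  | zero => simp
  | succ n ih =>
    rw [Finset.sum_range_succ, Finset.sum_range_succ (fun i => d i * x i), mul_add]
    have := mul_le_mul_of_nonneg_right (hd (Nat.le_succ n)) (hx (n + 1))
    linarith

end convexity

/-! ### Weights of a single Schur polynomial and the facets of its Newton polytope. -/

section weights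

variable {m : ℕ} {μ : Fin m → ℕ}

/-- The weights of the Schur polynomial `s_μ`: its exponent vectors. -/
def weights (μ : Fin m → ℕ) : Set (Fin m → ℝ) :=
  (fun (α : Fin m →₀ ℕ) (i : Fin m) => (α i : ℝ)) '' ((schurPoly μ).support : Set (Fin m →₀ ℕ))

theorem newtonPolytope_schurPoly (μ : Fin m → ℕ) :
    newtonPolytope (schurPoly μ) = convexHull ℝ (weights μ) := rfl

theorem newtonPolytope_inflatedGrothendieck (h : ℕ) (lam : Fin m → ℕ) :
    newtonPolytope (inflatedGrothendieck h lam)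
      = convexHull ℝ (⋃ μ ∈ inflatedSupport h lam, weights μ) := by
  rw [newtonPolytope]
  congr 1
  ext x
  simp only [weights, Set.mem_image, Set.mem_iUnion, Finset.mem_coe,
    mem_support_inflatedGrothendieck]
  exact ⟨fun ⟨α, ⟨μ, hμ, hα⟩, hx⟩ => ⟨μ, hμ, α, hα, hx⟩,
    fun ⟨μ, hμ, α, hα, hx⟩ => ⟨α, ⟨μ, hμ, hα⟩, hx⟩⟩

theorem sum_indVec_mul (I : Finset (Fin m)) (x : Fin m → ℝ) :
    ∑ i, indVec I i * x i = ∑ i ∈ I, x i := by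
  simp [indVec, Finset.sum_ite_mem]

theorem sum_neg_indVec_mul (I : Finset (Fin m)) (x : Fin m → ℝ) :
    ∑ i, (-indVec I) i * x i = -∑ i ∈ I, x i := by
  simp only [Pi.neg_apply, neg_mul, Finset.sum_neg_distrib, sum_indVec_mul]

theorem headSum_add_tailSum (μ : Fin m → ℕ) (r : ℕ) :
    headSum μ r + tailSum μ r = ∑ i, μ i := by
  rw [headSum, tailSum, ← Finset.sum_filter_add_sum_filter_not univ fun i : Fin m => i.val < r]
  simp only [not_lt]

theorem sum_eq_of_mem_weights {x : Fin m → ℝ} (hx : x ∈ weights μ) :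
    ∑ i, x i = ((∑ i, μ i : ℕ) : ℝ) := by
  obtain ⟨α, hα, rfl⟩ := hx
  rw [← sum_eq_of_mem_support_schurPoly hα, Nat.cast_sum]

theorem nonneg_of_mem_weights {x : Fin m → ℝ} (hx : x ∈ weights μ) (i : Fin m) : 0 ≤ x i := by
  obtain ⟨α, -, rfl⟩ := hx
  exact Nat.cast_nonneg _

theorem sum_le_headSum (hμ : Antitone μ) {x : Fin m → ℝ} (hx : x ∈ weights μ)
    (I : Finset (Fin m)) : ∑ i ∈ I, x i ≤ headSum μ I.card := by
  obtain ⟨α, hα, rfl⟩ := hx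
  obtain ⟨T, hT, rfl⟩ := mem_support_schurPoly.1 hα
  have := sum_content_le_headSum hμ hT I
  simp only
  exact_mod_cast this

theorem sum_add_sum_compl_of_mem_weights {x : Fin m → ℝ} (hx : x ∈ weights μ)
    (I : Finset (Fin m)) :
    ∑ i ∈ I, x i + ∑ i ∈ Iᶜ, x i = headSum μ I.card + tailSum μ I.card := by
  rw [Finset.sum_add_sum_compl, sum_eq_of_mem_weights hx, ← headSum_add_tailSum μ I.card,
    Nat.cast_add]

theorem tailSum_le_sum_compl (hμ : Antitone μ) {x : Fin m → ℝ} (hx : x ∈ weights μ)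
    (I : Finset (Fin m)) : (tailSum μ I.card : ℝ) ≤ ∑ i ∈ Iᶜ, x i := by
  have h1 := sum_add_sum_compl_of_mem_weights hx I
  have h2 := sum_le_headSum hμ hx I
  linarith

theorem headSum_one (μ : Fin m → ℕ) (i : Fin m) (hi : i.val = 0) : headSum μ 1 = μ i := by
  have : (univ.filter fun j : Fin m => j.val < 1) = {i} := by
    ext j
    simp only [mem_filter, mem_univ, true_and, mem_singleton, Fin.ext_iff, hi]
    omega
  rw [headSum, this, Finset.sum_singleton]

theorem le_of_mem_weights (hμ : Antitone μ) {x : Fin m → ℝ} (hx : x ∈ weights μ) {i : Fin m}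
    (hi : i.val = 0) (j : Fin m) : x j ≤ μ i := by
  have := sum_le_headSum hμ hx {j}
  rwa [Finset.sum_singleton, Finset.card_singleton, headSum_one μ i hi] at this

theorem perm_mem_weights (hμ : Antitone μ) (w : Equiv.Perm (Fin m)) :
    (fun i => (μ (w i) : ℝ)) ∈ weights μ := by
  obtain ⟨T, hT, h⟩ := exists_semistandard_content hμ w
  refine ⟨content T, Finset.mem_coe.2 (mem_support_schurPoly.2 ⟨T, hT, rfl⟩), ?_⟩
  funext i
  rw [← h i]

theorem exists_perm_mem_iff (I : Finset (Fin m)) :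
    ∃ w : Equiv.Perm (Fin m), ∀ i, i ∈ I ↔ (w i).val < I.card := by
  have hI : I.card ≤ m := by simpa using Finset.card_le_univ I
  have hc : Fintype.card {i // i ∈ I} = Fintype.card {i : Fin m // i.val < I.card} := by
    rw [Fintype.card_coe, Fintype.card_subtype, Fin.card_filter_val_lt, min_eq_right hI]
  let e := Fintype.equivOfCardEq hc
  refine ⟨e.extendSubtype, fun i => ⟨fun hi => e.extendSubtype_mem i hi, fun hi => ?_⟩⟩
  by_contra hn
  exact e.extendSubtype_not_mem i hn hi

theorem sum_perm_eq_headSum {I : Finset (Fin m)} {w : Equiv.Perm (Fin m)}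
    (hw : ∀ i, i ∈ I ↔ (w i).val < I.card) :
    ∑ i ∈ I, (μ (w i) : ℝ) = headSum μ I.card := by
  rw [headSum, Nat.cast_sum]
  refine Finset.sum_bij (fun i _ => w i) (fun i hi => by simpa using (hw i).1 hi)
    (fun _ _ _ _ h => w.injective h) (fun j hj => ⟨w.symm j, ?_, by simp⟩) fun _ _ => rfl
  rw [hw]
  simpa using hj

/-- If `S` contains a rearrangement of `μ` together with the results of swapping two of its
entries in positions from `I`, and these entries are not all equal, then a functional that is
constant on `S` has equal coefficients on `I`. -/
theorem eq_of_mem_constFun_of_swap {S : Set (Fin m → ℝ)} {u : Fin m → ℝ} (hu : u ∈ constFun S)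
    {w : Equiv.Perm (Fin m)} {I : Finset (Fin m)} (hw : (fun i => (μ (w i) : ℝ)) ∈ S)
    (hS : ∀ i ∈ I, ∀ j ∈ I, (fun l => (μ (w (Equiv.swap i j l)) : ℝ)) ∈ S)
    (hne : ∃ i ∈ I, ∃ j ∈ I, μ (w i) ≠ μ (w j)) : ∀ i ∈ I, ∀ j ∈ I, u i = u j := by
  -- The swap changes the value of `u` by the product of the difference of the two entries and that
  -- of the two coefficients.
  have key : ∀ i ∈ I, ∀ j ∈ I, μ (w i) ≠ μ (w j) → u i = u j := by
    intro i hi j hj hij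
    have hne : i ≠ j := fun h => hij (h ▸ rfl)
    have h1 := mem_constFun.1 hu _ hw _ (hS i hi j hj)
    rw [← sub_eq_zero, ← Finset.sum_sub_distrib,
      ← Finset.sum_subset (Finset.subset_univ {i, j}) (by
        intro l _ hl
        simp only [mem_insert, mem_singleton, not_or] at hl
        rw [Equiv.swap_apply_of_ne_of_ne hl.1 hl.2, sub_self]), Finset.sum_pair hne] at h1
    simp only [Equiv.swap_apply_left, Equiv.swap_apply_right] at h1
    have h2 : ((μ (w i) : ℝ) - μ (w j)) * (u i - u j) = 0 := by linarith
    have h3 : (μ (w i) : ℝ) - μ (w j) ≠ 0 := sub_ne_zero.2 (by exact_mod_cast hij)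
    exact sub_eq_zero.1 ((mul_eq_zero.1 h2).resolve_left h3)
  obtain ⟨p, hp, q, hq, hpq⟩ := hne
  intro i hi j hj
  -- Positions with equal entries are compared through `p` or `q`, one of which carries a different
  -- entry.
  by_cases hij : μ (w i) = μ (w j)
  · by_cases hip : μ (w i) = μ (w p)
    · have hiq : μ (w i) ≠ μ (w q) := hip ▸ hpq
      exact (key i hi q hq hiq).trans (key j hj q hq (hij ▸ hiq)).symm
    · exact (key i hi p hp hip).trans (key j hj p hp (hij ▸ hip)).symm
  · exact key i hi j hj hij

theorem eq_of_mem_constFun_weights (hμ : Antitone μ) (hne : ∃ i j, μ i ≠ μ j) {u : Fin m → ℝ}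
    (hu : u ∈ constFun (weights μ)) (i j : Fin m) : u i = u j := by
  obtain ⟨p, q, hpq⟩ := hne
  exact eq_of_mem_constFun_of_swap (w := 1) (I := univ) hu (perm_mem_weights hμ 1)
    (fun i _ j _ => perm_mem_weights hμ (Equiv.swap i j))
    ⟨p, mem_univ _, q, mem_univ _, hpq⟩ i (mem_univ _) j (mem_univ _)

/-- The points of the face of `Newt(s_μ)` on which `∑_{i ∈ I} x_i` is maximal. -/
def weightFace (μ : Fin m → ℕ) (I : Finset (Fin m)) : Set (Fin m → ℝ) :=
  weights μ ∩ {x | ∑ i, indVec I i * x i = headSum μ I.card}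

theorem perm_mem_weightFace (hμ : Antitone μ) {I : Finset (Fin m)} {w : Equiv.Perm (Fin m)}
    (hw : ∀ i, i ∈ I ↔ (w i).val < I.card) : (fun i => (μ (w i) : ℝ)) ∈ weightFace μ I := by
  refine ⟨perm_mem_weights hμ w, ?_⟩
  rw [Set.mem_ofPred_eq, sum_indVec_mul]
  exact sum_perm_eq_headSum hw

theorem weightFace_nonempty (hμ : Antitone μ) (I : Finset (Fin m)) : (weightFace μ I).Nonempty := by
  obtain ⟨w, hw⟩ := exists_perm_mem_iff I
  exact ⟨_, perm_mem_weightFace hμ hw⟩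

theorem perm_swap_mem_weightFace (hμ : Antitone μ) {I : Finset (Fin m)} {w : Equiv.Perm (Fin m)}
    (hw : ∀ i, i ∈ I ↔ (w i).val < I.card) {i j : Fin m} (hij : i ∈ I ↔ j ∈ I) :
    (fun l => (μ (w (Equiv.swap i j l)) : ℝ)) ∈ weightFace μ I := by
  refine perm_mem_weightFace (w := (Equiv.swap i j).trans w) hμ fun l => ?_
  rw [Equiv.trans_apply, ← hw]
  by_cases h1 : l = i
  · rw [h1, Equiv.swap_apply_left, hij]
  · by_cases h2 : l = j
    · rw [h2, Equiv.swap_apply_right, hij]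
    · rw [Equiv.swap_apply_of_ne_of_ne h1 h2]

theorem eq_of_mem_constFun_weightFace (hμ : Antitone μ) {I : Finset (Fin m)}
    (hI : I.card = 1 ∨ ∃ i j : Fin m, i.val < I.card ∧ j.val < I.card ∧ μ i ≠ μ j)
    {u : Fin m → ℝ} (hu : u ∈ constFun (weightFace μ I)) : ∀ i ∈ I, ∀ j ∈ I, u i = u j := by
  rcases hI with hI | ⟨p, q, hp, hq, hpq⟩
  · intro i hi j hj
    rw [Finset.card_le_one.1 hI.le i hi j hj]
  · obtain ⟨w, hw⟩ := exists_perm_mem_iff I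
    refine eq_of_mem_constFun_of_swap hu (perm_mem_weightFace hμ hw)
      (fun i hi j hj => perm_swap_mem_weightFace hμ hw (iff_of_true hi hj))
      ⟨w.symm p, ?_, w.symm q, ?_, ?_⟩
    · simpa [hw] using hp
    · simpa [hw] using hq
    · simpa using hpq

theorem eq_of_mem_constFun_weightFace_compl (hμ : Antitone μ) {I : Finset (Fin m)}
    (hI : Iᶜ.card = 1 ∨ ∃ i j : Fin m, I.card ≤ i.val ∧ I.card ≤ j.val ∧ μ i ≠ μ j)
    {u : Fin m → ℝ} (hu : u ∈ constFun (weightFace μ I)) : ∀ i ∈ Iᶜ, ∀ j ∈ Iᶜ, u i = u j := by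
  rcases hI with hI | ⟨p, q, hp, hq, hpq⟩
  · intro i hi j hj
    rw [Finset.card_le_one.1 hI.le i hi j hj]
  · obtain ⟨w, hw⟩ := exists_perm_mem_iff I
    refine eq_of_mem_constFun_of_swap hu (perm_mem_weightFace hμ hw)
      (fun i hi j hj => perm_swap_mem_weightFace hμ hw
        (iff_of_false (Finset.mem_compl.1 hi) (Finset.mem_compl.1 hj)))
      ⟨w.symm p, ?_, w.symm q, ?_, ?_⟩
    · simpa [hw] using hp
    · simpa [hw] using hq
    · simpa using hpq

theorem linearIndependent_one_indVec {I : Finset (Fin m)} (h1 : I.Nonempty) (h2 : I ≠ univ) :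
    LinearIndependent ℝ ![(1 : Fin m → ℝ), indVec I] := by
  obtain ⟨i, hi⟩ := h1
  obtain ⟨j, hj⟩ : ∃ j, j ∉ I := by
    by_contra hcon
    push Not at hcon
    exact h2 (Finset.eq_univ_iff_forall.2 hcon)
  rw [LinearIndependent.pair_iff]
  intro s t hst
  have e1 := congrFun hst i
  have e2 := congrFun hst j
  simp [indVec, hi] at e1
  simp [indVec, hj] at e2
  subst e2
  simpa using e1

theorem span_one_indVec_le (μ : Fin m → ℕ) (I : Finset (Fin m)) :
    Submodule.span ℝ (Set.range ![(1 : Fin m → ℝ), indVec I]) ≤ constFun (weightFace μ I) := by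
  rw [Submodule.span_le]
  rintro _ ⟨k, rfl⟩
  fin_cases k
  · refine mem_constFun_of_eq (c := ((∑ i, μ i : ℕ) : ℝ)) fun x hx => ?_
    simp [← sum_eq_of_mem_weights hx.1]
  · exact mem_constFun_face _ _ _

theorem finrank_constFun_weights [NeZero m] (hμ : Antitone μ) (hne : ∃ i j, μ i ≠ μ j) :
    Module.finrank ℝ (constFun (weights μ)) = 1 := by
  have h1 : (1 : Fin m → ℝ) ∈ constFun (weights μ) :=
    mem_constFun_of_eq (c := ((∑ i, μ i : ℕ) : ℝ)) fun x hx => by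
      simp [← sum_eq_of_mem_weights hx]
  refine finrank_eq_one (⟨1, h1⟩ : constFun (weights μ)) ?_ fun u => ⟨u.1 0, Subtype.ext ?_⟩
  · intro h
    have := congrFun (congrArg Subtype.val h) (0 : Fin m)
    simp at this
  · funext i
    simpa using eq_of_mem_constFun_weights hμ hne u.2 0 i

/-- Swaps within `I` and within `Iᶜ` preserve the face, so functionals constant on it are constant
on both blocks. They form the plane spanned by `1` and `indVec I`, one dimension more than for all
weights. -/
theorem isFacetIneq_weights [NeZero m] (hμ : Antitone μ) {I : Finset (Fin m)} (h1 : I.Nonempty)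
    (h2 : I ≠ univ) (hne : ∃ i j, μ i ≠ μ j)
    (hI : I.card = 1 ∨ ∃ i j : Fin m, i.val < I.card ∧ j.val < I.card ∧ μ i ≠ μ j)
    (hI' : Iᶜ.card = 1 ∨ ∃ i j : Fin m, I.card ≤ i.val ∧ I.card ≤ j.val ∧ μ i ≠ μ j) :
    IsFacetIneq (weights μ) (indVec I) (headSum μ I.card) := by
  rw [isFacetIneq_iff_finrank_constFun]
  refine ⟨fun x hx => ?_, weightFace_nonempty hμ I, ?_⟩
  · rw [sum_indVec_mul]
    exact sum_le_headSum hμ hx I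
  · rw [finrank_constFun_weights hμ hne]
    change Module.finrank ℝ (constFun (weightFace μ I)) = 2
    rw [← le_antisymm (span_one_indVec_le μ I) ?_,
      finrank_span_eq_card (linearIndependent_one_indVec h1 h2), Fintype.card_fin]
    intro u hu
    obtain ⟨i, hi⟩ := h1
    obtain ⟨j, hj⟩ : ∃ j, j ∉ I := by
      by_contra hcon
      push Not at hcon
      exact h2 (Finset.eq_univ_iff_forall.2 hcon)
    rw [Matrix.range_cons, Matrix.range_cons, Matrix.range_empty, Set.union_empty,
      Set.singleton_union, Submodule.mem_span_pair]
    refine ⟨u j, u i - u j, funext fun l => ?_⟩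
    by_cases hl : l ∈ I
    · simp [indVec, hl, eq_of_mem_constFun_weightFace hμ hI hu l hl i hi]
    · simp [indVec, hl, eq_of_mem_constFun_weightFace_compl hμ hI' hu l
        (Finset.mem_compl.2 hl) j (Finset.mem_compl.2 hj)]

/-- For constant `μ` there is only one weight, and a point has no facets. -/
theorem IsFacetIneq.exists_ne (hμ : Antitone μ) {a : Fin m → ℝ} {c : ℝ}
    (hf : IsFacetIneq (weights μ) a c) : ∃ i j, μ i ≠ μ j := by
  by_contra! hcon
  have hm : 0 < m := by
    by_contra hm
    have h2 := (isFacetIneq_iff_finrank_constFun.1 hf).2.2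
    have h3 := affDim_add_finrank_constFun (weights μ ∩ {x | ∑ i, a i * x i = c})
    omega
  have htop : constFun (weights μ) = ⊤ := by
    refine eq_top_iff.2 fun u _ => mem_constFun.2 fun x hx y hy => ?_
    have key : ∀ x ∈ weights μ, ∀ i, x i = μ ⟨0, hm⟩ := by
      intro x hx i
      have hle := le_of_mem_weights (i := ⟨0, hm⟩) hμ hx rfl
      have hsum : ∑ i, x i = ∑ i : Fin m, (μ ⟨0, hm⟩ : ℝ) := by
        rw [sum_eq_of_mem_weights hx, Nat.cast_sum]
        exact Finset.sum_congr rfl fun j _ => by rw [hcon j ⟨0, hm⟩]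
      exact (Finset.sum_eq_sum_iff_of_le fun i _ => hle i).1 hsum i (mem_univ _)
    exact Finset.sum_congr rfl fun i _ => by rw [key x hx, key y hy]
  have h2 := (isFacetIneq_iff_finrank_constFun.1 hf).2.2
  rw [htop, finrank_top, Module.finrank_fin_fun] at h2
  have h3 := affDim_add_finrank_constFun (weights μ ∩ {x | ∑ i, a i * x i = c})
  omega

theorem IsFacetIneq.exists_of_mem_constFun (hμ : Antitone μ) {I : Finset (Fin m)}
    (h1 : I.Nonempty) (h2 : I ≠ univ)
    (hf : IsFacetIneq (weights μ) (indVec I) (headSum μ I.card)) {u : Fin m → ℝ}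
    (hu : u ∈ constFun (weightFace μ I)) : ∃ s t : ℝ, u = s • (1 : Fin m → ℝ) + t • indVec I := by
  obtain ⟨i, hi⟩ := h1
  have : NeZero m := ⟨by have := i.2; omega⟩
  have h3 := (isFacetIneq_iff_finrank_constFun.1 hf).2.2
  rw [finrank_constFun_weights hμ (hf.exists_ne hμ)] at h3
  have h4 := Submodule.eq_of_le_of_finrank_eq (span_one_indVec_le μ I) (by
    rw [finrank_span_eq_card (linearIndependent_one_indVec ⟨i, hi⟩ h2), Fintype.card_fin]
    exact h3.symm)
  rw [← h4, Matrix.range_cons, Matrix.range_cons, Matrix.range_empty, Set.union_empty,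
      Set.singleton_union, Submodule.mem_span_pair] at hu
  obtain ⟨s, t, h⟩ := hu
  exact ⟨s, t, h.symm⟩

/-- If the first `I.card` parts agree, each coordinate in `I` is fixed on the face; a single
coordinate is then a constant functional outside the span of `1` and `indVec I`. -/
theorem IsFacetIneq.exists_ne_of_lt_card (hμ : Antitone μ) {I : Finset (Fin m)}
    (h1 : I.Nonempty) (h2 : I ≠ univ) (hc : I.card ≠ 1)
    (hf : IsFacetIneq (weights μ) (indVec I) (headSum μ I.card)) :
    ∃ i j : Fin m, i.val < I.card ∧ j.val < I.card ∧ μ i ≠ μ j := by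
  by_contra! hcon
  obtain ⟨i, hi, j, hj, hij⟩ := Finset.one_lt_card.1
    (lt_of_le_of_ne (Finset.card_pos.2 h1) (Ne.symm hc))
  have hm : 0 < m := by have := i.2; omega
  have key : ∀ x ∈ weightFace μ I, x i = μ ⟨0, hm⟩ := by
    intro x hx
    have hle := le_of_mem_weights (i := ⟨0, hm⟩) hμ hx.1 rfl
    have hI : I.card ≤ m := by simpa using Finset.card_le_univ I
    have hs : ∑ i ∈ I, x i = ∑ i ∈ I, (μ ⟨0, hm⟩ : ℝ) := by
      have := hx.2
      rw [Set.mem_ofPred_eq, sum_indVec_mul] at this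
      rw [this, headSum, Nat.cast_sum, Finset.sum_const, Finset.sum_congr rfl (g := fun _ =>
        (μ ⟨0, hm⟩ : ℝ)) (fun l hl => ?_), Finset.sum_const, Fin.card_filter_val_lt,
        min_eq_right hI]
      rw [hcon l ⟨0, hm⟩ (by simpa using hl) (Finset.card_pos.2 h1)]
    exact (Finset.sum_eq_sum_iff_of_le fun i _ => hle i).1 hs i hi
  have hu : Pi.single i (1 : ℝ) ∈ constFun (weightFace μ I) :=
    mem_constFun_of_eq (c := μ ⟨0, hm⟩) fun x hx => by
      rw [← key x hx]
      simp [Pi.single_apply]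
  obtain ⟨s, t, h⟩ := hf.exists_of_mem_constFun hμ h1 h2 hu
  have e1 := congrFun h i
  have e2 := congrFun h j
  simp [indVec, hi] at e1
  simp [indVec, hj, hij.symm] at e2
  linarith

theorem isFacetIneq_neg_indVec_compl_iff {I : Finset (Fin m)} :
    IsFacetIneq (weights μ) (-indVec Iᶜ) (-(tailSum μ I.card : ℝ)) ↔
      IsFacetIneq (weights μ) (indVec I) (headSum μ I.card) := by
  have h : ∀ x ∈ weights μ, ∑ i, (-indVec Iᶜ) i * x i - -(tailSum μ I.card : ℝ)
      = ∑ i, indVec I i * x i - headSum μ I.card := by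
    intro x hx
    rw [sum_indVec_mul, sum_neg_indVec_mul]
    linarith [sum_add_sum_compl_of_mem_weights hx I]
  exact ⟨fun hf => hf.of_sub_eq one_pos fun x hx => by rw [one_mul, h x hx],
    fun hf => hf.of_sub_eq one_pos fun x hx => by rw [one_mul, h x hx]⟩

end weights

/-! ### The interval of shapes and the greedy sequence. -/

section partitions

variable {m h : ℕ} {lam : Fin m → ℕ}

/-- The largest partition in `A(h, lam)`. -/
def topPart (h : ℕ) (lam : Fin m → ℕ) (i : Fin m) : ℕ :=
  (Iic i).inf' ⟨i, Finset.mem_Iic.2 le_rfl⟩ fun j => lam j + h * j.val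

theorem topPart_antitone (h : ℕ) (lam : Fin m → ℕ) : Antitone (topPart h lam) := by
  intro i j hij
  exact Finset.inf'_mono _ (Finset.Iic_subset_Iic.2 hij) _

theorem le_topPart (hlam : Antitone lam) : lam ≤ topPart h lam := by
  intro i
  refine (Finset.le_inf'_iff _ _).2 fun j hj => ?_
  exact (hlam (Finset.mem_Iic.1 hj)).trans (Nat.le_add_right _ _)

theorem topPart_le (h : ℕ) (lam : Fin m → ℕ) (i : Fin m) : topPart h lam i ≤ lam i + h * i.val :=
  Finset.inf'_le _ (Finset.mem_Iic.2 le_rfl)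

theorem le_topPart_of_antitone {μ : Fin m → ℕ} (hμ : Antitone μ)
    (hle : ∀ i, μ i ≤ lam i + h * i.val) : μ ≤ topPart h lam := by
  intro i
  refine (Finset.le_inf'_iff _ _).2 fun j hj => ?_
  exact (hμ (Finset.mem_Iic.1 hj)).trans (hle j)

theorem mem_inflatedSupport_iff_le (hh : 1 ≤ h) {μ : Fin m → ℕ} :
    μ ∈ inflatedSupport h lam ↔ Antitone μ ∧ lam ≤ μ ∧ μ ≤ topPart h lam := by
  rw [mem_inflatedSupport_iff hh]
  exact and_congr_right fun hμ => and_congr_right fun _ =>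
    ⟨le_topPart_of_antitone hμ, fun hle i => (hle i).trans (topPart_le h lam i)⟩

theorem topPart_zero {i : Fin m} (hi : i.val = 0) : topPart h lam i = lam i := by
  refine le_antisymm ((topPart_le h lam i).trans (by simp [hi])) ?_
  refine (Finset.le_inf'_iff _ _).2 fun j hj => ?_
  have : j = i := le_antisymm (Finset.mem_Iic.1 hj) (Fin.le_def.2 (by omega))
  rw [this]
  exact Nat.le_add_right _ _

theorem pos_of_antitone_of_ne_zero (hlam : Antitone lam) (hne : lam ≠ 0) {i : Fin m}
    (hi : i.val = 0) : 0 < lam i := by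
  by_contra hcon
  refine hne (funext fun j => ?_)
  have := hlam (show i ≤ j from Fin.le_def.2 (by omega))
  simp only [Pi.zero_apply]
  omega

theorem topPart_pos (hh : 1 ≤ h) (hlam : Antitone lam) (hne : lam ≠ 0) (i : Fin m) :
    0 < topPart h lam i := by
  refine (Finset.lt_inf'_iff _).2 fun j _ => ?_
  by_cases hj : j.val = 0
  · have := pos_of_antitone_of_ne_zero hlam hne hj
    omega
  · have := Nat.mul_pos hh (Nat.pos_of_ne_zero hj)
    omega

/-- The partition obtained from `lam` by filling up the first `k` rows. -/
def midPart (h : ℕ) (lam : Fin m → ℕ) (k : ℕ) (i : Fin m) : ℕ :=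
  if i.val < k then topPart h lam i else lam i

theorem midPart_of_lt {k : ℕ} {i : Fin m} (hi : i.val < k) :
    midPart h lam k i = topPart h lam i := if_pos hi

theorem midPart_of_le {k : ℕ} {i : Fin m} (hi : k ≤ i.val) :
    midPart h lam k i = lam i := if_neg (not_lt.2 hi)

theorem midPart_zero : midPart h lam 0 = lam := funext fun _ => midPart_of_le (Nat.zero_le _)

theorem midPart_self : midPart h lam m = topPart h lam := funext fun i => midPart_of_lt i.2

theorem midPart_one : midPart h lam 1 = lam := by
  funext i
  by_cases hi : i.val = 0
  · rw [midPart_of_lt (by omega), topPart_zero hi]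
  · exact midPart_of_le (by omega)

/-- The partitions between `lam` and `topPart h lam` whose boxes outside `lam` fill up the rows
one after the other. -/
def IsRowFilling (h : ℕ) (lam ν : Fin m → ℕ) : Prop :=
  lam ≤ ν ∧ ν ≤ topPart h lam ∧ ∀ i j, i < j → lam j < ν j → ν i = topPart h lam i

theorem IsRowFilling.antitone (hlam : Antitone lam) {ν : Fin m → ℕ} (hν : IsRowFilling h lam ν) :
    Antitone ν := by
  intro i j hij
  rcases hij.eq_or_lt with rfl | hlt
  · exact le_rfl
  · rcases (hν.1 j).eq_or_lt with he | hl
    · rw [← he]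
      exact (hlam hij).trans (hν.1 i)
    · rw [hν.2.2 i j hlt hl]
      exact (hν.2.1 j).trans (topPart_antitone h lam hij)

/-- Row fillings form a chain: if `ν i < ν' i` for one `i`, then `ν ≤ ν'`, so the sizes differ.
Hence the greedy partitions can be identified by size alone. -/
theorem IsRowFilling.eq_of_sum_eq {ν ν' : Fin m → ℕ} (hν : IsRowFilling h lam ν)
    (hν' : IsRowFilling h lam ν') (hs : ∑ i, ν i = ∑ i, ν' i) : ν = ν' := by
  have key : ∀ {ν ν' : Fin m → ℕ}, IsRowFilling h lam ν → IsRowFilling h lam ν' →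
      ∑ i, ν i = ∑ i, ν' i → ∀ i, ¬ ν i < ν' i := by
    intro ν ν' hν hν' hs i hi
    refine hs.not_lt (Finset.sum_lt_sum (fun j _ => ?_) ⟨i, mem_univ _, hi⟩)
    rcases lt_trichotomy j i with hj | hj | hj
    · rw [hν'.2.2 j i hj ((hν.1 i).trans_lt hi)]
      exact hν.2.1 j
    · exact hj ▸ hi.le
    · by_contra hlt
      have h1 := hν.2.2 i j hj ((hν'.1 j).trans_lt (not_le.1 hlt))
      have h2 : ν' i ≤ topPart h lam i := hν'.2.1 i
      omega
  funext i
  exact le_antisymm (not_lt.1 (key hν' hν hs.symm i)) (not_lt.1 (key hν hν' hs i))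

theorem isRowFilling_midPart (hlam : Antitone lam) (k : ℕ) :
    IsRowFilling h lam (midPart h lam k) := by
  have h0 := le_topPart (h := h) hlam
  refine ⟨fun i => ?_, fun i => ?_, fun i j hij hj => ?_⟩
  · unfold midPart
    split_ifs
    · exact h0 i
    · exact le_rfl
  · unfold midPart
    split_ifs
    · exact le_rfl
    · exact h0 i
  · refine midPart_of_lt ?_
    by_contra hcon
    rw [midPart_of_le (by rw [Fin.lt_def] at hij; omega)] at hj
    exact lt_irrefl _ hj

theorem midPart_antitone (hlam : Antitone lam) (k : ℕ) : Antitone (midPart h lam k) :=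
  (isRowFilling_midPart hlam k).antitone hlam

theorem midPart_mem_inflatedSupport (hh : 1 ≤ h) (hlam : Antitone lam) (k : ℕ) :
    midPart h lam k ∈ inflatedSupport h lam :=
  (mem_inflatedSupport_iff_le hh).2
    ⟨midPart_antitone hlam k, (isRowFilling_midPart hlam k).1, (isRowFilling_midPart hlam k).2.1⟩

theorem IsRowFilling.lt_topPart_of_addable {ν : Fin m → ℕ}
    (hν : IsRowFilling h lam ν) {r : Fin m} (hr : Addable h lam ν r) : ν r < topPart h lam r := by
  have h1 : Function.update ν r (ν r + 1) r ≤ topPart h lam r :=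
    le_topPart_of_antitone hr.2 (fun i => ?_) r
  · rw [Function.update_self] at h1
    exact h1
  · by_cases hi : i = r
    · rw [hi, Function.update_self]
      exact hr.1
    · rw [Function.update_of_ne hi]
      exact (hν.2.1 i).trans (topPart_le h lam i)

theorem IsRowFilling.update {ν : Fin m → ℕ} (hν : IsRowFilling h lam ν) {r : Fin m}
    (hr : ν r < topPart h lam r) (hmin : ∀ i < r, ν i = topPart h lam i) :
    IsRowFilling h lam (Function.update ν r (ν r + 1)) := by
  refine ⟨fun i => ?_, fun i => ?_, fun i j hij hj => ?_⟩
  · by_cases hi : i = r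
    · rw [hi, Function.update_self]
      exact (hν.1 r).trans (Nat.le_succ _)
    · rw [Function.update_of_ne hi]
      exact hν.1 i
  · by_cases hi : i = r
    · rw [hi, Function.update_self]
      exact hr
    · rw [Function.update_of_ne hi]
      exact hν.2.1 i
  · by_cases hjr : j = r
    · rw [Function.update_of_ne (hjr ▸ hij.ne)]
      exact hmin i (hjr ▸ hij)
    · rw [Function.update_of_ne hjr] at hj
      have h1 := hν.2.2 i j hij hj
      by_cases hir : i = r
      · rw [hir] at h1
        omega
      · rw [Function.update_of_ne hir, h1]

/-- The first addable row is the first row below its cap in `topPart`, so rows are filled in order,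
one box per step. The minimum accounts for the constant continuation after `topPart` is reached. -/
theorem domSeq_spec (hlam : Antitone lam) (k : ℕ) :
    IsRowFilling h lam (domSeq h lam k) ∧
      ∑ i, domSeq h lam k i = min (∑ i, lam i + k) (∑ i, topPart h lam i) := by
  classical
  induction k with
  | zero =>
    refine ⟨⟨le_rfl, le_topPart hlam, fun i j _ hj => absurd hj (lt_irrefl _)⟩, ?_⟩
    rw [domSeq, Nat.add_zero, min_eq_left (Finset.sum_le_sum fun i _ => le_topPart hlam i)]
  | succ k ih =>
    obtain ⟨hν, hs⟩ := ih
    rw [domSeq]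
    set ν := domSeq h lam k
    have hadd : ∀ r, ν r < topPart h lam r → (∀ i < r, ν i = topPart h lam i) →
        Addable h lam ν r := fun r hr hmin =>
      ⟨hr.trans_le (topPart_le h lam r), (hν.update hr hmin).antitone hlam⟩
    have hex : (univ.filter fun r => ν r < topPart h lam r).Nonempty →
        ∃ r, ν r < topPart h lam r ∧ ∀ i < r, ν i = topPart h lam i := by
      intro hne
      obtain ⟨r, hr, hmin⟩ := Finset.exists_min_image _ id hne
      refine ⟨r, (Finset.mem_filter.1 hr).2, fun i hi => ?_⟩
      by_contra hcon
      have h1 : r ≤ i := hmin i (Finset.mem_filter.2 ⟨mem_univ _, lt_of_le_of_ne (hν.2.1 i) hcon⟩)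
      exact absurd h1 (not_le.2 hi)
    split_ifs with H
    · have hmem := (Finset.mem_filter.1 (Finset.min'_mem _ H)).2
      have hmin : ∀ i, Addable h lam ν i → (univ.filter (Addable h lam ν)).min' H ≤ i :=
        fun i hi => Finset.min'_le _ i (Finset.mem_filter.2 ⟨mem_univ _, hi⟩)
      generalize (univ.filter (Addable h lam ν)).min' H = r at hmem hmin ⊢
      have hr := hν.lt_topPart_of_addable hmem
      have hlow : ∀ i < r, ν i = topPart h lam i := by
        -- The first unfilled row `r'` is addable, so the first addable row `r` does not come after
        -- it.
        obtain ⟨r', hr', hlow'⟩ := hex ⟨r, Finset.mem_filter.2 ⟨mem_univ _, hr⟩⟩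
        have h1 := hmin r' (hadd r' hr' hlow')
        exact fun i hi => hlow' i (hi.trans_le h1)
      refine ⟨hν.update hr hlow, ?_⟩
      have h2 : ∑ i, ν i < ∑ i, topPart h lam i :=
        Finset.sum_lt_sum (fun i _ => hν.2.1 i) ⟨r, mem_univ _, hr⟩
      rw [Finset.sum_update_of_mem (mem_univ _)]
      have h3 := Finset.sum_sdiff (f := ν) (Finset.subset_univ {r})
      rw [Finset.sum_singleton] at h3
      omega
    · refine ⟨hν, ?_⟩
      have hfull : ν = topPart h lam := by
        funext i
        by_contra hcon
        obtain ⟨r, hr, hlow⟩ := hex ⟨i, Finset.mem_filter.2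
          ⟨mem_univ _, lt_of_le_of_ne (hν.2.1 i) hcon⟩⟩
        exact H ⟨r, Finset.mem_filter.2 ⟨mem_univ _, hadd r hr hlow⟩⟩
      rw [hfull] at hs ⊢
      omega

theorem domSeq_eq_topPart (hlam : Antitone lam) {N : ℕ}
    (hN : ∑ i, topPart h lam i = ∑ i, lam i + N) : domSeq h lam N = topPart h lam := by
  obtain ⟨h1, h2⟩ := domSeq_spec (h := h) hlam N
  refine h1.eq_of_sum_eq (midPart_self (h := h) (lam := lam) ▸ isRowFilling_midPart hlam m) ?_
  rw [h2, hN, min_self]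

theorem domSeq_boxSum (hlam : Antitone lam) {N : ℕ}
    (hN : ∑ i, topPart h lam i = ∑ i, lam i + N) (k : ℕ) :
    domSeq h lam (boxSum h lam N k) = midPart h lam k := by
  obtain ⟨h1, h2⟩ := domSeq_spec (h := h) hlam (boxSum h lam N k)
  have h3 : ∑ i, lam i + boxSum h lam N k = ∑ i, midPart h lam k i := by
    rw [boxSum, domSeq_eq_topPart hlam hN, Finset.sum_filter, ← Finset.sum_add_distrib]
    refine Finset.sum_congr rfl fun i _ => ?_
    have h4 : lam i ≤ topPart h lam i := le_topPart hlam i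
    unfold midPart
    split_ifs <;> omega
  refine h1.eq_of_sum_eq (isRowFilling_midPart hlam k) ?_
  rw [h2, h3, min_eq_left (Finset.sum_le_sum fun i _ => (isRowFilling_midPart hlam k).2.1 i)]

theorem totalDegree_inflatedGrothendieck (hh : 1 ≤ h) (hlam : Antitone lam) :
    (inflatedGrothendieck h lam).totalDegree = ∑ i, topPart h lam i := by
  have hsum : ∀ α : Fin m →₀ ℕ, (α.sum fun _ e => e) = ∑ i, α i := fun α =>
    Finsupp.sum_fintype _ _ fun _ => rfl
  refine le_antisymm (Finset.sup_le fun α hα => ?_) ?_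
  · obtain ⟨μ, hμ, hαμ⟩ := mem_support_inflatedGrothendieck.1 hα
    rw [hsum, sum_eq_of_mem_support_schurPoly hαμ]
    exact Finset.sum_le_sum fun i _ => ((mem_inflatedSupport_iff_le hh).1 hμ).2.2 i
  · obtain ⟨T, hT, -⟩ := exists_semistandard_content (topPart_antitone h lam) 1
    have h1 := mem_support_schurPoly.2 ⟨T, hT, rfl⟩
    have h2 := midPart_mem_inflatedSupport hh hlam m
    rw [midPart_self] at h2
    rw [← sum_eq_of_mem_support_schurPoly h1, ← hsum]
    exact MvPolynomial.le_totalDegree (mem_support_inflatedGrothendieck.2 ⟨_, h2, h1⟩)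

end partitions

/-! ### Which of the candidate inequalities are facets of `Newt(G)`. -/

section facets

variable {m h : ℕ} {lam : Fin m → ℕ}

/-- The exponent vectors of `G_{h, lam}`. -/
def allWeights (h : ℕ) (lam : Fin m → ℕ) : Set (Fin m → ℝ) :=
  ⋃ μ ∈ inflatedSupport h lam, weights μ

theorem mem_allWeights (hh : 1 ≤ h) {x : Fin m → ℝ} :
    x ∈ allWeights h lam ↔
      ∃ μ, Antitone μ ∧ lam ≤ μ ∧ μ ≤ topPart h lam ∧ x ∈ weights μ := by
  simp only [allWeights, Set.mem_iUnion, mem_inflatedSupport_iff_le hh, exists_prop, and_assoc]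

theorem weights_midPart_subset (hh : 1 ≤ h) (hlam : Antitone lam) (k : ℕ) :
    weights (midPart h lam k) ⊆ allWeights h lam :=
  Set.subset_biUnion_of_mem (u := fun μ => weights μ) (midPart_mem_inflatedSupport hh hlam k)

theorem weights_subset_allWeights (hh : 1 ≤ h) (hlam : Antitone lam) :
    weights lam ⊆ allWeights h lam := by
  have := weights_midPart_subset hh hlam 0
  rwa [midPart_zero] at this

theorem headSum_mono {μ ν : Fin m → ℕ} (hle : μ ≤ ν) (r : ℕ) : headSum μ r ≤ headSum ν r :=
  Finset.sum_le_sum fun i _ => hle i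

theorem tailSum_mono {μ ν : Fin m → ℕ} (hle : μ ≤ ν) (r : ℕ) : tailSum μ r ≤ tailSum ν r :=
  Finset.sum_le_sum fun i _ => hle i

theorem headSum_congr {μ ν : Fin m → ℕ} {r : ℕ} (he : ∀ i : Fin m, i.val < r → μ i = ν i) :
    headSum μ r = headSum ν r :=
  Finset.sum_congr rfl fun i hi => he i (by simpa using hi)

theorem tailSum_congr {μ ν : Fin m → ℕ} {r : ℕ} (he : ∀ i : Fin m, r ≤ i.val → μ i = ν i) :
    tailSum μ r = tailSum ν r :=
  Finset.sum_congr rfl fun i hi => he i (by simpa using hi)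

theorem headSum_midPart {r k : ℕ} (hrk : r ≤ k) :
    headSum (midPart h lam k) r = headSum (topPart h lam) r :=
  headSum_congr fun _ hi => midPart_of_lt (hi.trans_le hrk)

theorem tailSum_midPart {r k : ℕ} (hrk : k ≤ r) :
    tailSum (midPart h lam k) r = tailSum lam r :=
  tailSum_congr fun _ hi => midPart_of_le (hrk.trans hi)

theorem exists_ne_of_ne_zero (hlam : Antitone lam) (hne : lam ≠ 0) {l : Fin m}
    (hl : lam l = 0) : ∃ i j, lam i ≠ lam j := by
  have hm : 0 < m := by have := l.2; omega
  refine ⟨⟨0, hm⟩, l, ?_⟩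
  rw [hl]
  exact (pos_of_antitone_of_ne_zero hlam hne rfl).ne'

/-- Since `lam` is not constant, its rearrangements force equal coefficients; `topPart` has larger
size than `lam`, so the common coefficient is zero. -/
theorem constFun_allWeights (hh : 1 ≤ h) (hlam : Antitone lam) (hne : lam ≠ 0) {l : Fin m}
    (hl : lam l = 0) : constFun (allWeights h lam) = ⊥ := by
  refine (Submodule.eq_bot_iff _).2 fun u hu => ?_
  have h1 := eq_of_mem_constFun_weights hlam (exists_ne_of_ne_zero hlam hne hl)
    (constFun_anti (weights_subset_allWeights hh hlam) hu)
  have h2 := mem_constFun.1 hu _ (weights_subset_allWeights hh hlam (perm_mem_weights hlam 1)) _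
    (weights_midPart_subset hh hlam m (perm_mem_weights (midPart_antitone hlam m) 1))
  rw [midPart_self] at h2
  have h3 : ∀ x : Fin m → ℝ, ∑ i, u i * x i = u l * ∑ i, x i := fun x => by
    rw [Finset.mul_sum]
    exact Finset.sum_congr rfl fun i _ => by rw [h1 i l]
  rw [h3, h3] at h2
  have h4 : ∑ i, (lam ((1 : Equiv.Perm (Fin m)) i) : ℝ)
      < ∑ i, (topPart h lam ((1 : Equiv.Perm (Fin m)) i) : ℝ) := by
    refine Finset.sum_lt_sum (fun i _ => Nat.cast_le.2 (le_topPart hlam _)) ⟨l, mem_univ _, ?_⟩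
    have := topPart_pos hh hlam hne l
    simpa [hl] using this
  have h5 : u l = 0 := by
    by_contra h5
    exact h4.ne (mul_left_cancel₀ h5 h2)
  funext i
  rw [h1 i l, h5, Pi.zero_apply]

theorem isFacetIneq_neg_univ (hh : 1 ≤ h) (hlam : Antitone lam) (hne : lam ≠ 0) {l : Fin m}
    (hl : lam l = 0) :
    IsFacetIneq (allWeights h lam) (-indVec univ) (-((∑ i, lam i : ℕ) : ℝ)) := by
  rw [isFacetIneq_iff_of_constFun_eq_bot (constFun_allWeights hh hlam hne hl)]
  have hface : ∀ x ∈ weights lam, ∑ i, (-indVec univ) i * x i = -((∑ i, lam i : ℕ) : ℝ) :=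
    fun x hx => by rw [sum_neg_indVec_mul, sum_eq_of_mem_weights hx]
  refine ⟨fun x hx => ?_, ⟨_, weights_subset_allWeights hh hlam (perm_mem_weights hlam 1),
    hface _ (perm_mem_weights hlam 1)⟩, fun h0 => ?_, fun u hu => ⟨-u l, ?_⟩⟩
  · obtain ⟨μ, -, hμ, -, hx⟩ := (mem_allWeights hh).1 hx
    rw [sum_neg_indVec_mul, sum_eq_of_mem_weights hx, neg_le_neg_iff, Nat.cast_le]
    exact Finset.sum_le_sum fun i _ => hμ i
  · have := congrFun h0 l
    simp [indVec] at this
  · have hsub : weights lam ⊆ allWeights h lam ∩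
        {x | ∑ i, (-indVec univ) i * x i = -((∑ i, lam i : ℕ) : ℝ)} :=
      fun x hx => ⟨weights_subset_allWeights hh hlam hx, hface x hx⟩
    have h1 := eq_of_mem_constFun_weights hlam (exists_ne_of_ne_zero hlam hne hl)
      (constFun_anti hsub hu)
    funext i
    simp [indVec, h1 i l]

theorem sum_le_sum_topPart (hh : 1 ≤ h) {x : Fin m → ℝ} (hx : x ∈ allWeights h lam) :
    ∑ i, indVec univ i * x i ≤ ((∑ i, topPart h lam i : ℕ) : ℝ) := by
  obtain ⟨μ, -, -, hμ, hx⟩ := (mem_allWeights hh).1 hx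
  rw [sum_indVec_mul, sum_eq_of_mem_weights hx, Nat.cast_le]
  exact Finset.sum_le_sum fun i _ => hμ i

theorem exists_sum_eq_sum_topPart (hh : 1 ≤ h) (hlam : Antitone lam) :
    ∃ x ∈ allWeights h lam, ∑ i, indVec univ i * x i = ((∑ i, topPart h lam i : ℕ) : ℝ) := by
  have h1 := perm_mem_weights (midPart_antitone (h := h) hlam m) 1
  refine ⟨_, weights_midPart_subset hh hlam m h1, ?_⟩
  rw [sum_indVec_mul, sum_eq_of_mem_weights h1, midPart_self]

theorem exists_perm_comp_ne_iff {f : Fin m → ℕ} :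
    (∃ σ : Equiv.Perm (Fin m), f ∘ σ ≠ f) ↔ ∃ i j, f i ≠ f j := by
  constructor
  · rintro ⟨σ, hσ⟩
    obtain ⟨i, hi⟩ := Function.ne_iff.1 hσ
    exact ⟨σ i, i, hi⟩
  · rintro ⟨i, j, hij⟩
    refine ⟨Equiv.swap i j, fun he => hij ?_⟩
    have := congrFun he j
    simpa using this

theorem isFacetIneq_univ_iff (hh : 1 ≤ h) (hlam : Antitone lam) (hne : lam ≠ 0) {l : Fin m}
    (hl : lam l = 0) :
    IsFacetIneq (allWeights h lam) (indVec univ) ((∑ i, topPart h lam i : ℕ) : ℝ) ↔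
      ∃ i j, topPart h lam i ≠ topPart h lam j := by
  rw [isFacetIneq_iff_of_constFun_eq_bot (constFun_allWeights hh hlam hne hl)]
  constructor
  · rintro ⟨-, -, -, hC⟩
    by_contra! hcon
    have hm : 0 < m := by have := l.2; omega
    have key : ∀ x ∈ allWeights h lam ∩
        {x | ∑ i, indVec univ i * x i = ((∑ i, topPart h lam i : ℕ) : ℝ)},
        ∀ i, x i = topPart h lam ⟨0, hm⟩ := by
      rintro x ⟨hx, hs⟩ i
      obtain ⟨μ, hanti, -, hμ, hx⟩ := (mem_allWeights hh).1 hx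
      rw [Set.mem_ofPred_eq, sum_indVec_mul] at hs
      have hle : ∀ i, x i ≤ topPart h lam ⟨0, hm⟩ := fun i =>
        (le_of_mem_weights (i := ⟨0, hm⟩) hanti hx rfl i).trans (Nat.cast_le.2 (hμ _))
      have hs' : ∑ i, x i = ∑ i : Fin m, (topPart h lam ⟨0, hm⟩ : ℝ) := by
        rw [hs, Nat.cast_sum]
        exact Finset.sum_congr rfl fun i _ => by rw [hcon i]
      exact (Finset.sum_eq_sum_iff_of_le fun i _ => hle i).1 hs' i (mem_univ _)
    -- For constant `topPart` the face is one point, so even a single coordinate is constant on it.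
    -- As `l` is not row `0`, it is no multiple of the all-ones vector.
    obtain ⟨t, ht⟩ := hC (Pi.single l 1) (mem_constFun_of_eq (c := topPart h lam ⟨0, hm⟩)
      fun x hx => Eq.trans (by simp [Pi.single_apply]) (key x hx l))
    have hl0 : l ≠ ⟨0, hm⟩ := by
      rintro rfl
      exact (pos_of_antitone_of_ne_zero hlam hne rfl).ne' hl
    have e1 := congrFun ht l
    have e2 := congrFun ht ⟨0, hm⟩
    simp [indVec] at e1
    simp [indVec, hl0.symm] at e2
    exact one_ne_zero (e1.trans e2.symm)
  · intro hne'
    refine ⟨fun x hx => sum_le_sum_topPart hh hx, exists_sum_eq_sum_topPart hh hlam,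
      fun h0 => ?_, fun u hu => ⟨u l, ?_⟩⟩
    · have := congrFun h0 l
      simp [indVec] at this
    · have hsub := weights_midPart_subset hh hlam m
      rw [midPart_self] at hsub
      have hsub' : weights (topPart h lam) ⊆ allWeights h lam ∩
          {x | ∑ i, indVec univ i * x i = ((∑ i, topPart h lam i : ℕ) : ℝ)} :=
        fun x hx => ⟨hsub hx, by
          rw [Set.mem_ofPred_eq, sum_indVec_mul, sum_eq_of_mem_weights hx]⟩
      have h1 := eq_of_mem_constFun_weights (topPart_antitone h lam) hne'
        (constFun_anti hsub' hu)
      funext i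
      simp [indVec, h1 i l]

theorem sum_le_headSum_topPart (hh : 1 ≤ h) (I : Finset (Fin m)) {x : Fin m → ℝ}
    (hx : x ∈ allWeights h lam) : ∑ i, indVec I i * x i ≤ headSum (topPart h lam) I.card := by
  obtain ⟨μ, hanti, -, hμ, hx⟩ := (mem_allWeights hh).1 hx
  rw [sum_indVec_mul]
  exact (sum_le_headSum hanti hx I).trans (Nat.cast_le.2 (headSum_mono hμ _))

/-- For `I.card ≤ k` the shape `midPart h lam k` already has the largest possible first `I.card`
rows; this is the origin of the condition on `k` in (c). -/
theorem weightFace_subset_head (hh : 1 ≤ h) (hlam : Antitone lam) {I : Finset (Fin m)} {k : ℕ}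
    (hk : I.card ≤ k) : weightFace (midPart h lam k) I ⊆
      allWeights h lam ∩ {x | ∑ i, indVec I i * x i = headSum (topPart h lam) I.card} :=
  fun _ hx => ⟨weights_midPart_subset hh hlam k hx.1, hx.2.trans (by rw [headSum_midPart hk])⟩

theorem exists_sum_eq_headSum_topPart (hh : 1 ≤ h) (hlam : Antitone lam) (I : Finset (Fin m)) :
    ∃ x ∈ allWeights h lam, ∑ i, indVec I i * x i = headSum (topPart h lam) I.card := by
  obtain ⟨x, hx⟩ := weightFace_nonempty (midPart_antitone (h := h) hlam I.card) I
  exact ⟨x, weightFace_subset_head hh hlam le_rfl hx⟩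

theorem neg_sum_compl_le (hh : 1 ≤ h) (I : Finset (Fin m)) {x : Fin m → ℝ}
    (hx : x ∈ allWeights h lam) : ∑ i, (-indVec Iᶜ) i * x i ≤ -(tailSum lam I.card : ℝ) := by
  obtain ⟨μ, hanti, hμ, -, hx⟩ := (mem_allWeights hh).1 hx
  rw [sum_neg_indVec_mul, neg_le_neg_iff]
  exact (Nat.cast_le.2 (tailSum_mono hμ _)).trans (tailSum_le_sum_compl hanti hx I)

theorem weightFace_subset_tail (hh : 1 ≤ h) (hlam : Antitone lam) {I : Finset (Fin m)} {k : ℕ}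
    (hk : k ≤ I.card) : weightFace (midPart h lam k) I ⊆
      allWeights h lam ∩ {x | ∑ i, (-indVec Iᶜ) i * x i = -(tailSum lam I.card : ℝ)} := by
  refine fun x hx => ⟨weights_midPart_subset hh hlam k hx.1, ?_⟩
  have h1 := hx.2
  have h2 := sum_add_sum_compl_of_mem_weights hx.1 I
  rw [Set.mem_ofPred_eq, sum_indVec_mul] at h1
  rw [Set.mem_ofPred_eq, sum_neg_indVec_mul, neg_inj, ← tailSum_midPart (h := h) hk]
  linarith

theorem exists_neg_sum_compl_eq (hh : 1 ≤ h) (hlam : Antitone lam) (I : Finset (Fin m)) :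
    ∃ x ∈ allWeights h lam, ∑ i, (-indVec Iᶜ) i * x i = -(tailSum lam I.card : ℝ) := by
  obtain ⟨x, hx⟩ := weightFace_nonempty (midPart_antitone (h := h) hlam I.card) I
  exact ⟨x, weightFace_subset_tail hh hlam le_rfl hx⟩

theorem sum_one_add_indVec_mul (s t : ℝ) (I : Finset (Fin m)) (x : Fin m → ℝ) :
    ∑ i, (s • (1 : Fin m → ℝ) + t • indVec I) i * x i = s * ∑ i, x i + t * ∑ i ∈ I, x i := by
  rw [← sum_indVec_mul I, Finset.mul_sum, Finset.mul_sum, ← Finset.sum_add_distrib]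
  refine Finset.sum_congr rfl fun i _ => ?_
  simp only [Pi.add_apply, Pi.smul_apply, Pi.one_apply, smul_eq_mul]
  ring

theorem exists_notMem_of_ne_univ {I : Finset (Fin m)} (h2 : I ≠ univ) : ∃ j, j ∉ I := by
  by_contra hcon
  push Not at hcon
  exact h2 (Finset.eq_univ_iff_forall.2 hcon)

theorem card_lt_of_ne_univ {I : Finset (Fin m)} (h2 : I ≠ univ) : I.card < m := by
  simpa using Finset.card_lt_univ_of_notMem (exists_notMem_of_ne_univ h2).choose_spec

theorem isFacetIneq_head_of_midPart (hh : 1 ≤ h) (hlam : Antitone lam) (hne : lam ≠ 0)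
    {l : Fin m} (hlm : l.val + 1 = m) (hl : lam l = 0) {I : Finset (Fin m)} (h1 : I.Nonempty)
    (h2 : I ≠ univ) {k : ℕ} (hk : I.card ≤ k)
    (hf : IsFacetIneq (weights (midPart h lam k)) (indVec I)
      (headSum (midPart h lam k) I.card)) :
    IsFacetIneq (allWeights h lam) (indVec I) (headSum (topPart h lam) I.card) := by
  rw [isFacetIneq_iff_of_constFun_eq_bot (constFun_allWeights hh hlam hne hl)]
  refine ⟨fun x hx => sum_le_headSum_topPart hh I hx, exists_sum_eq_headSum_topPart hh hlam I,
    fun h0 => ?_, fun u hu => ?_⟩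
  · obtain ⟨i, hi⟩ := h1
    have := congrFun h0 i
    simp [indVec, hi] at this
  · have hIm := card_lt_of_ne_univ h2
    obtain ⟨s, t, rfl⟩ := hf.exists_of_mem_constFun (midPart_antitone hlam k) h1 h2
      (constFun_anti (weightFace_subset_head hh hlam hk) hu)
    -- Two points of the face with the same sum over `I` but different total sums, because the last
    -- row is empty in one shape and not in the other; this gives `s = 0`.
    obtain ⟨x, hx⟩ := weightFace_nonempty (midPart_antitone (h := h) hlam I.card) I
    obtain ⟨y, hy⟩ := weightFace_nonempty (midPart_antitone (h := h) hlam m) I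
    have hx' := weightFace_subset_head hh hlam le_rfl hx
    have hy' := weightFace_subset_head hh hlam hIm.le hy
    have e := mem_constFun.1 hu x hx' y hy'
    have ex := hx'.2
    have ey := hy'.2
    rw [Set.mem_ofPred_eq, sum_indVec_mul] at ex ey
    rw [sum_one_add_indVec_mul, sum_one_add_indVec_mul, ex, ey, sum_eq_of_mem_weights hx.1,
      sum_eq_of_mem_weights hy.1] at e
    have hlt : ∑ i, midPart h lam I.card i < ∑ i, midPart h lam m i := by
      rw [midPart_self]
      refine Finset.sum_lt_sum (fun i _ => (isRowFilling_midPart hlam _).2.1 i)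
        ⟨l, mem_univ _, ?_⟩
      rw [midPart_of_le (by omega), hl]
      exact topPart_pos hh hlam hne l
    have hs : s = 0 := by
      by_contra hs
      have := mul_left_cancel₀ hs (add_right_cancel e)
      exact hlt.ne (by exact_mod_cast this)
    exact ⟨t, by rw [hs, zero_smul, zero_add]⟩

theorem exists_facet_midPart_of_head (hh : 1 ≤ h) (hlam : Antitone lam) (hne : lam ≠ 0)
    {l : Fin m} (hlm : l.val + 1 = m) (hl : lam l = 0) {I : Finset (Fin m)} (h1 : I.Nonempty)
    (h2 : I ≠ univ)
    (hf : IsFacetIneq (allWeights h lam) (indVec I) (headSum (topPart h lam) I.card)) :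
    ∃ k ∈ Icc 1 m, I.card ≤ k ∧ IsFacetIneq (weights (midPart h lam k)) (indVec I)
      (headSum (midPart h lam k) I.card) := by
  have hm : 0 < m := by omega
  have : NeZero m := ⟨hm.ne'⟩
  have hI0 : 0 < I.card := Finset.card_pos.2 h1
  have hIm := card_lt_of_ne_univ h2
  have hC := ((isFacetIneq_iff_of_constFun_eq_bot (constFun_allWeights hh hlam hne hl)).1 hf).2.2.2
  have cond : I.card = 1 ∨ ∃ i j : Fin m, i.val < I.card ∧ j.val < I.card ∧
      topPart h lam i ≠ topPart h lam j := by
    by_contra! hcon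
    obtain ⟨hc, hcon⟩ := hcon
    obtain ⟨i, hi, j, hj, hij⟩ := Finset.one_lt_card.1 (lt_of_le_of_ne hI0 (Ne.symm hc))
    have key : ∀ x ∈ allWeights h lam ∩
        {x | ∑ i, indVec I i * x i = headSum (topPart h lam) I.card},
        x i = topPart h lam ⟨0, hm⟩ := by
      rintro x ⟨hx, hs⟩
      obtain ⟨μ, hanti, -, hμ, hx⟩ := (mem_allWeights hh).1 hx
      rw [Set.mem_ofPred_eq, sum_indVec_mul] at hs
      have hle : ∀ i, x i ≤ topPart h lam ⟨0, hm⟩ := fun i =>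
        (le_of_mem_weights (i := ⟨0, hm⟩) hanti hx rfl i).trans (Nat.cast_le.2 (hμ _))
      have hs' : ∑ i ∈ I, x i = ∑ i ∈ I, (topPart h lam ⟨0, hm⟩ : ℝ) := by
        rw [hs, headSum, Nat.cast_sum, Finset.sum_const, Finset.sum_congr rfl (g := fun _ =>
          (topPart h lam ⟨0, hm⟩ : ℝ)) (fun p hp => ?_), Finset.sum_const,
          Fin.card_filter_val_lt, min_eq_right hIm.le]
        rw [hcon p ⟨0, hm⟩ (by simpa using hp) hI0]
      exact (Finset.sum_eq_sum_iff_of_le fun i _ => hle i).1 hs' i hi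
    obtain ⟨t, ht⟩ := hC (Pi.single i 1) (mem_constFun_of_eq (c := topPart h lam ⟨0, hm⟩)
      fun x hx => Eq.trans (by simp [Pi.single_apply]) (key x hx))
    have e1 := congrFun ht i
    have e2 := congrFun ht j
    simp [indVec, hi] at e1
    simp [indVec, hj, hij.symm] at e2
    exact one_ne_zero (e1.trans e2.symm)
  -- With `k < m` the last part of `midPart h lam k` is still zero, so the shape is not constant.
  have main : ∀ k, I.card ≤ k → k + 1 ≤ m →
      (Iᶜ.card = 1 ∨ ∃ i j : Fin m, I.card ≤ i.val ∧ I.card ≤ j.val ∧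
        midPart h lam k i ≠ midPart h lam k j) →
      ∃ k ∈ Icc 1 m, I.card ≤ k ∧ IsFacetIneq (weights (midPart h lam k)) (indVec I)
        (headSum (midPart h lam k) I.card) := by
    intro k hk hkm hcompl
    refine ⟨k, Finset.mem_Icc.2 ⟨by omega, by omega⟩, hk,
      isFacetIneq_weights (midPart_antitone hlam k) h1 h2 ⟨⟨0, hm⟩, l, ?_⟩ ?_ hcompl⟩
    · rw [midPart_of_lt (by simp only; omega), midPart_of_le (by omega), hl]
      exact (topPart_pos hh hlam hne _).ne'
    · refine cond.imp_right ?_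
      rintro ⟨i, j, hi, hj, hij⟩
      refine ⟨i, j, hi, hj, ?_⟩
      rwa [midPart_of_lt (by omega), midPart_of_lt (by omega)]
  by_cases hc1 : Iᶜ.card = 1
  · exact main I.card le_rfl hIm (Or.inl hc1)
  -- The parts from row `I.card` on must not all agree. If `lam` vanishes there, one more row is
  -- filled to obtain a positive part above the zero last part.
  · by_cases hr : lam ⟨I.card, hIm⟩ = 0
    · have hlt : I.card + 1 < m := by
        rw [Finset.card_compl, Fintype.card_fin] at hc1
        omega
      refine main (I.card + 1) (Nat.le_succ _) hlt (Or.inr ⟨⟨I.card, hIm⟩, l, le_rfl, by omega, ?_⟩)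
      rw [midPart_of_lt (by simp only; omega), midPart_of_le (by omega), hl]
      exact (topPart_pos hh hlam hne _).ne'
    · refine main I.card le_rfl hIm (Or.inr ⟨⟨I.card, hIm⟩, l, le_rfl, by omega, ?_⟩)
      rw [midPart_of_le (by simp only; exact le_rfl), midPart_of_le (by omega), hl]
      exact hr

theorem lt_topPart (hh : 1 ≤ h) (hlam : Antitone lam) {z i : Fin m} (hz : z.val = 0)
    (hi : lam i < lam z) : lam i < topPart h lam i := by
  refine (Finset.lt_inf'_iff _).2 fun j hj => ?_
  by_cases hj0 : j.val = 0
  · have : j = z := Fin.ext (by omega)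
    rw [this]
    omega
  · have := Nat.mul_pos hh (Nat.pos_of_ne_zero hj0)
    have := hlam (Finset.mem_Iic.1 hj)
    omega

/-- Filling the first `I.card` rows of `lam` keeps the tail but changes the size, so a functional `s
• 1 + t • indVec I` constant on the face has `s + t = 0`. -/
theorem isFacetIneq_tail_of_midPart (hh : 1 ≤ h) (hlam : Antitone lam) (hne : lam ≠ 0)
    {l : Fin m} (hl : lam l = 0) {I : Finset (Fin m)} (h1 : I.Nonempty)
    (h2 : I ≠ univ) {k : ℕ} (hk : k ≤ I.card) (hc : I.card ≠ 1)
    (hf : IsFacetIneq (weights (midPart h lam k)) (indVec I)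
      (headSum (midPart h lam k) I.card)) :
    IsFacetIneq (allWeights h lam) (-indVec Iᶜ) (-(tailSum lam I.card : ℝ)) := by
  rw [isFacetIneq_iff_of_constFun_eq_bot (constFun_allWeights hh hlam hne hl)]
  refine ⟨fun x hx => neg_sum_compl_le hh I hx, exists_neg_sum_compl_eq hh hlam I,
    fun h0 => ?_, fun u hu => ?_⟩
  · obtain ⟨i, hi⟩ := exists_notMem_of_ne_univ h2
    have := congrFun h0 i
    simp [indVec, hi] at this
  · obtain ⟨i, j, hi, hj, hij⟩ := hf.exists_ne_of_lt_card (midPart_antitone hlam k) h1 h2 hc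
    obtain ⟨s, t, rfl⟩ := hf.exists_of_mem_constFun (midPart_antitone hlam k) h1 h2
      (constFun_anti (weightFace_subset_tail hh hlam hk) hu)
    obtain ⟨x, hx⟩ := weightFace_nonempty (midPart_antitone (h := h) hlam 0) I
    obtain ⟨y, hy⟩ := weightFace_nonempty (midPart_antitone (h := h) hlam I.card) I
    have hx' := weightFace_subset_tail hh hlam (Nat.zero_le _) hx
    have hy' := weightFace_subset_tail hh hlam le_rfl hy
    have e := mem_constFun.1 hu x hx' y hy'
    have ex := hx'.2
    have ey := hy'.2
    have sx := Finset.sum_add_sum_compl I x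
    have sy := Finset.sum_add_sum_compl I y
    rw [Set.mem_ofPred_eq, sum_neg_indVec_mul, neg_inj] at ex ey
    rw [ex, sum_eq_of_mem_weights hx.1] at sx
    rw [ey, sum_eq_of_mem_weights hy.1] at sy
    rw [sum_one_add_indVec_mul, sum_one_add_indVec_mul, sum_eq_of_mem_weights hx.1,
      sum_eq_of_mem_weights hy.1] at e
    have hlt : ∑ i, midPart h lam 0 i < ∑ i, midPart h lam I.card i := by
      rw [midPart_zero]
      refine Finset.sum_lt_sum (fun i _ => (isRowFilling_midPart hlam _).1 i) ?_
      -- If none of these rows can grow, all are as long as row `0` by `lt_topPart`, so the shape is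
      -- constant there, against `exists_ne_of_lt_card`.
      by_contra! hcon
      have hm : 0 < m := by have := l.2; omega
      have hconst : ∀ p : Fin m, p.val < I.card → midPart h lam k p = lam ⟨0, hm⟩ := by
        intro p hp
        have h3 := hcon p (mem_univ _)
        rw [midPart_of_lt hp] at h3
        have h4 : lam p ≤ topPart h lam p := le_topPart hlam p
        have h5 : lam p ≤ lam ⟨0, hm⟩ := hlam (Fin.le_def.2 (Nat.zero_le _))
        have h6 : lam p = lam ⟨0, hm⟩ := by
          refine le_antisymm h5 (not_lt.1 fun h6 => ?_)
          have := lt_topPart (z := ⟨0, hm⟩) hh hlam rfl h6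
          omega
        unfold midPart
        split_ifs <;> omega
      exact hij ((hconst i hi).trans (hconst j hj).symm)
    have hst : s + t = 0 := by
      have hlt' : ((∑ i, midPart h lam 0 i : ℕ) : ℝ) < ((∑ i, midPart h lam I.card i : ℕ) : ℝ) :=
        Nat.cast_lt.2 hlt
      have : (s + t) * (((∑ i, midPart h lam 0 i : ℕ) : ℝ)
          - ((∑ i, midPart h lam I.card i : ℕ) : ℝ)) = 0 := by
        rw [← sx, ← sy] at e ⊢
        linarith
      exact (mul_eq_zero.1 this).resolve_right (sub_ne_zero.2 hlt'.ne)
    refine ⟨-s, funext fun p => ?_⟩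
    by_cases hp : p ∈ I
    · simp [indVec, hp, hst]
    · simp [indVec, hp]

theorem facet_of_tail (hh : 1 ≤ h) (hlam : Antitone lam) (hne : lam ≠ 0)
    {l : Fin m} (hlm : l.val + 1 = m) (hl : lam l = 0) {I : Finset (Fin m)} (h1 : I.Nonempty)
    (h2 : I ≠ univ)
    (hf : IsFacetIneq (allWeights h lam) (-indVec Iᶜ) (-(tailSum lam I.card : ℝ))) :
    I.card ≠ 1 ∧ IsFacetIneq (weights lam) (indVec I) (headSum lam I.card) := by
  have hm : 0 < m := by omega
  have : NeZero m := ⟨hm.ne'⟩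
  have hI0 : 0 < I.card := Finset.card_pos.2 h1
  have hIm := card_lt_of_ne_univ h2
  have hC := ((isFacetIneq_iff_of_constFun_eq_bot (constFun_allWeights hh hlam hne hl)).1 hf).2.2.2
  have hsum : ∀ x ∈ allWeights h lam ∩
      {x | ∑ i, (-indVec Iᶜ) i * x i = -(tailSum lam I.card : ℝ)},
      ∑ i ∈ Iᶜ, x i = tailSum lam I.card := by
    intro x hx
    have := hx.2
    rwa [Set.mem_ofPred_eq, sum_neg_indVec_mul, neg_inj] at this
  -- Row `0` never grows. If the first `I.card` parts of `lam` agree, none of those rows can grow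
  -- either, so the total sum is constant on the face. This is what excludes `I.card = 1`.
  have cond : ∃ i j : Fin m, i.val < I.card ∧ j.val < I.card ∧ lam i ≠ lam j := by
    by_contra! hcon
    have key : ∀ x ∈ allWeights h lam ∩
        {x | ∑ i, (-indVec Iᶜ) i * x i = -(tailSum lam I.card : ℝ)},
        ∑ i, x i = ((∑ i, lam i : ℕ) : ℝ) := by
      intro x hx
      have hs := hsum x hx
      obtain ⟨μ, hanti, hμ, hμ', hx⟩ := (mem_allWeights hh).1 hx.1
      have h3 := tailSum_le_sum_compl hanti hx I
      rw [hs, Nat.cast_le] at h3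
      have h4 : headSum μ I.card ≤ headSum lam I.card := by
        refine Finset.sum_le_sum fun i hi => ?_
        have hi' : i.val < I.card := by simpa using hi
        have h5 : μ i ≤ μ ⟨0, hm⟩ := hanti (Fin.le_def.2 (Nat.zero_le _))
        have h6 : μ ⟨0, hm⟩ ≤ topPart h lam ⟨0, hm⟩ := hμ' _
        rw [topPart_zero rfl, hcon ⟨0, hm⟩ i hI0 hi'] at h6
        exact h5.trans h6
      have h7 : ∑ i, lam i ≤ ∑ i, μ i := Finset.sum_le_sum fun i _ => hμ i
      rw [sum_eq_of_mem_weights hx]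
      have h8 := headSum_add_tailSum μ I.card
      have h9 := headSum_add_tailSum lam I.card
      congr 1
      omega
    obtain ⟨t, ht⟩ := hC 1 (mem_constFun_of_eq fun x hx => by simpa using key x hx)
    obtain ⟨i, hi⟩ := h1
    have := congrFun ht i
    simp [indVec, hi] at this
  have cond' : Iᶜ.card = 1 ∨ ∃ i j : Fin m, I.card ≤ i.val ∧ I.card ≤ j.val ∧ lam i ≠ lam j := by
    by_contra! hcon
    obtain ⟨hc, hcon⟩ := hcon
    have hI0' : 0 < Iᶜ.card := by
      rw [Finset.card_compl, Fintype.card_fin]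
      omega
    obtain ⟨i, hi, j, hj, hij⟩ := Finset.one_lt_card.1 (lt_of_le_of_ne hI0' (Ne.symm hc))
    -- A constant tail equals the zero last part, so on the face the nonnegative coordinates outside
    -- `I` all vanish.
    have htail : tailSum lam I.card = 0 :=
      Finset.sum_eq_zero fun p hp => (hcon p l (by simpa using hp) (by omega)).trans hl
    have key : ∀ x ∈ allWeights h lam ∩
        {x | ∑ i, (-indVec Iᶜ) i * x i = -(tailSum lam I.card : ℝ)}, x i = 0 := by
      intro x hx
      have hs := hsum x hx
      obtain ⟨μ, -, -, -, hx⟩ := (mem_allWeights hh).1 hx.1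
      rw [htail, Nat.cast_zero, Finset.sum_eq_zero_iff_of_nonneg fun p _ =>
        nonneg_of_mem_weights hx p] at hs
      exact hs i hi
    obtain ⟨t, ht⟩ := hC (Pi.single i 1) (mem_constFun_of_eq (c := 0)
      fun x hx => Eq.trans (by simp [Pi.single_apply]) (key x hx))
    have e1 := congrFun ht i
    have e2 := congrFun ht j
    rw [Finset.mem_compl] at hi hj
    simp [indVec, hi] at e1
    simp [indVec, hj, hij.symm] at e2
    rw [e2] at e1
    simp at e1
  refine ⟨fun hc => ?_, isFacetIneq_weights hlam h1 h2 (exists_ne_of_ne_zero hlam hne hl)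
    (Or.inr cond) cond'⟩
  obtain ⟨i, j, hi, hj, hij⟩ := cond
  exact hij (congrArg lam (Fin.ext (by omega)))

end facets

/-! ### The possible facet normals. -/

section normals

variable {m h : ℕ} {lam : Fin m → ℕ}

theorem sum_mul_nonneg_of_partial_sums_nonneg {d x : Fin m → ℝ} (hd : Antitone d)
    (hx : ∀ r : ℕ, 0 ≤ ∑ i : Fin m with i.val < r, x i) (hx0 : ∑ i, x i = 0) :
    0 ≤ ∑ i, d i * x i := by
  rcases Nat.eq_zero_or_pos m with rfl | hm
  · simp
  obtain ⟨n, rfl⟩ : ∃ n, m = n + 1 := ⟨m - 1, by omega⟩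
  -- The weight is continued by its last value, which keeps it antitone, and `x` by zero.
  let d' : ℕ → ℝ := fun k => d ⟨min k n, by omega⟩
  let x' : ℕ → ℝ := fun k => if hk : k < n + 1 then x ⟨k, hk⟩ else 0
  have hxe : ∀ i : Fin (n + 1), x' i.val = x i := fun i => dif_pos i.2
  have hde : ∀ i : Fin (n + 1), d' i.val = d i := fun i =>
    congrArg d (Fin.ext (min_eq_left (Nat.lt_succ_iff.1 i.2)))
  have hd' : Antitone d' := fun a b hab => hd (Fin.le_def.2 (min_le_min_right n hab))
  have hx' : ∀ r, 0 ≤ ∑ i ∈ range r, x' i := by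
    intro r
    have h1 := hx r
    rw [Finset.sum_filter, Finset.sum_congr rfl (g := fun i : Fin (n + 1) =>
        (fun k : ℕ => if k < r then x' k else 0) i.val) (fun i _ => by simp only [hxe]),
      Fin.sum_univ_eq_sum_range (fun k : ℕ => if k < r then x' k else 0), ← Finset.sum_filter] at h1
    refine h1.trans (le_of_eq (Finset.sum_subset (fun k hk => ?_) fun k hk hk' => ?_))
    · simp only [mem_filter, mem_range] at hk ⊢
      exact hk.2
    · refine dif_neg fun hkn => hk' ?_
      simp only [mem_filter, mem_range] at hk ⊢
      exact ⟨hkn, hk⟩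
  have h2 := sum_mul_ge_of_partial_sums_nonneg hd' hx' n
  rw [← Fin.sum_univ_eq_sum_range x' (n + 1),
    ← Fin.sum_univ_eq_sum_range (fun k => d' k * x' k) (n + 1)] at h2
  simpa only [hxe, hde, hx0, mul_zero] using h2

/-- Subtracting the step of height `d p - d q` on the first `p + 1` positions leaves an antitone
weight, whose pairing with `x` is nonnegative. -/
theorem drop_mul_partial_sum_le {d x : Fin m → ℝ} (hd : Antitone d)
    (hx : ∀ r : ℕ, 0 ≤ ∑ i : Fin m with i.val < r, x i) (hx0 : ∑ i, x i = 0)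
    {p q : Fin m} (hpq : q.val = p.val + 1) :
    (d p - d q) * ∑ i : Fin m with i.val < p.val + 1, x i ≤ ∑ i, d i * x i := by
  have hle : d q ≤ d p := hd (Fin.le_def.2 (by omega))
  have hd' : Antitone fun i : Fin m => d i - if i.val < p.val + 1 then d p - d q else 0 := by
    intro i j hij
    have h1 := hd hij
    simp only
    split_ifs with h2 h3 h3
    · linarith
    · exact absurd ((Fin.le_def.1 hij).trans_lt h2) h3
    · have h4 := hd (show i ≤ p from Fin.le_def.2 (by omega))
      have h5 := hd (show q ≤ j from Fin.le_def.2 (by omega))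
      linarith
    · linarith
  have h1 := sum_mul_nonneg_of_partial_sums_nonneg hd' hx hx0
  simp only [sub_mul, Finset.sum_sub_distrib, ite_mul, zero_mul] at h1
  rw [← Finset.sum_filter] at h1
  rw [Finset.mul_sum]
  simp only [sub_mul]
  linarith

theorem exists_drop {d : Fin m → ℝ} (hd : Antitone d) (hne : ∃ i j, d i ≠ d j) :
    ∃ p q : Fin m, q.val = p.val + 1 ∧ d q < d p := by
  by_contra! hcon
  obtain ⟨i, j, hij⟩ := hne
  have hm : 0 < m := by have := i.2; omega
  have key : ∀ n (hn : n < m), d ⟨n, hn⟩ = d ⟨0, hm⟩ := by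
    intro n
    induction n with
    | zero => exact fun _ => rfl
    | succ n ih =>
      intro hn
      rw [← ih (by omega)]
      exact le_antisymm (hd (Fin.le_def.2 (Nat.le_succ n))) (hcon ⟨n, by omega⟩ ⟨n + 1, hn⟩ rfl)
  exact hij ((key i.val i.2).trans (key j.val j.2).symm)

theorem exists_perm_antitone_comp (a : Fin m → ℝ) :
    ∃ σ : Equiv.Perm (Fin m), Antitone (a ∘ σ) := by
  refine ⟨Tuple.sort (fun i => -a i), fun i j hij => ?_⟩
  exact neg_le_neg_iff.1 (Tuple.monotone_sort (fun i => -a i) hij)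

/-- The first letters in the order given by `σ`. -/
def initialLetters (σ : Equiv.Perm (Fin m)) (r : ℕ) : Finset (Fin m) :=
  (univ.filter fun i : Fin m => i.val < r).map σ.toEmbedding

theorem apply_mem_initialLetters {σ : Equiv.Perm (Fin m)} {r : ℕ} {i : Fin m} :
    σ i ∈ initialLetters σ r ↔ i.val < r := by
  simp [initialLetters]

theorem sum_initialLetters (σ : Equiv.Perm (Fin m)) (r : ℕ) (x : Fin m → ℝ) :
    ∑ i ∈ initialLetters σ r, x i = ∑ i : Fin m with i.val < r, x (σ i) := by
  rw [initialLetters, Finset.sum_map]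
  rfl

theorem card_initialLetters (σ : Equiv.Perm (Fin m)) (r : ℕ) :
    (initialLetters σ r).card = min m r := by
  rw [initialLetters, Finset.card_map, Fin.card_filter_val_lt]

theorem headSum_min (μ : Fin m → ℕ) (r : ℕ) : headSum μ (min m r) = headSum μ r := by
  rw [headSum, headSum]
  congr 1
  ext i
  have := i.2
  simp

/-- A point of a facet with normal vector `a` is a weight of some `μ` that is as large as
possible where `a` is positive and as small as possible where `a` is negative, and it lies on the
corresponding face of `Newt(s_μ)`. -/
theorem exists_shape_of_mem_face (hh : 1 ≤ h) (hlam : Antitone lam) {a : Fin m → ℝ} {c : ℝ}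
    (hf : ∀ x ∈ allWeights h lam, ∑ i, a i * x i ≤ c) {σ : Equiv.Perm (Fin m)}
    (hσ : Antitone (a ∘ σ)) {x : Fin m → ℝ} (hx : x ∈ allWeights h lam)
    (hxc : ∑ i, a i * x i = c) :
    ∃ μ, x ∈ weights μ ∧ (∀ i, 0 < a (σ i) → μ i = topPart h lam i) ∧
      (∀ i, a (σ i) < 0 → μ i = lam i) ∧
      ∀ p q : Fin m, q.val = p.val + 1 → a (σ q) < a (σ p) →
        ∑ i ∈ initialLetters σ (p.val + 1), x i = headSum μ (p.val + 1) := by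
  classical
  obtain ⟨μ, hanti, hμ, hμ', hx⟩ := (mem_allWeights hh).1 hx
  -- The shape maximising the pairing with `a ∘ σ`. It is a partition because the positive entries
  -- of `a ∘ σ` come first. The chain `c ≤ ∑ a (σ i) * μ i ≤ ∑ a (σ i) * ν i ≤ c` then consists of
  -- equalities.
  let ν : Fin m → ℕ := fun i => if 0 < a (σ i) then topPart h lam i else lam i
  have hν : Antitone ν := by
    intro i j hij
    have h1 : a (σ j) ≤ a (σ i) := hσ hij
    have h2 : lam j ≤ lam i := hlam hij
    have h3 : topPart h lam j ≤ topPart h lam i := topPart_antitone h lam hij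
    have h4 : lam i ≤ topPart h lam i := le_topPart hlam i
    simp only [ν]
    split_ifs with h5 h6
    · exact h3
    · exact absurd (h5.trans_le h1) h6
    · exact h2.trans h4
    · exact h2
  have hνle : lam ≤ ν ∧ ν ≤ topPart h lam := by
    constructor <;> intro i <;> simp only [ν] <;> split_ifs
    · exact le_topPart hlam i
    · exact le_rfl
    · exact le_rfl
    · exact le_topPart hlam i
  have e1 : ∑ i, a (σ i) * ν i ≤ c := by
    have := hf _ ((mem_allWeights hh).2 ⟨ν, hν, hνle.1, hνle.2, perm_mem_weights hν σ.symm⟩)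
    rw [← Equiv.sum_comp σ] at this
    simpa using this
  have e2 : ∀ i, a (σ i) * μ i ≤ a (σ i) * ν i := by
    intro i
    simp only [ν]
    split_ifs with h1
    · exact mul_le_mul_of_nonneg_left (Nat.cast_le.2 (hμ' i)) h1.le
    · exact mul_le_mul_of_nonpos_left (Nat.cast_le.2 (hμ i)) (not_lt.1 h1)
  have hy : ∀ r : ℕ, ∑ i : Fin m with i.val < r, ((μ i : ℝ) - x (σ i))
      = headSum μ r - ∑ i ∈ initialLetters σ r, x i := by
    intro r
    rw [Finset.sum_sub_distrib, sum_initialLetters, headSum, Nat.cast_sum]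
  have hy0 : ∀ r : ℕ, 0 ≤ ∑ i : Fin m with i.val < r, ((μ i : ℝ) - x (σ i)) := by
    intro r
    have := sum_le_headSum hanti hx (initialLetters σ r)
    rw [card_initialLetters, headSum_min] at this
    rw [hy]
    linarith
  have hyt : ∑ i, ((μ i : ℝ) - x (σ i)) = 0 := by
    rw [Finset.sum_sub_distrib, Equiv.sum_comp σ x, sum_eq_of_mem_weights hx, Nat.cast_sum, sub_self]
  have e3 : ∑ i, a (σ i) * ((μ i : ℝ) - x (σ i)) = ∑ i, a (σ i) * μ i - c := by
    simp only [mul_sub, Finset.sum_sub_distrib]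
    rw [Equiv.sum_comp σ fun i => a i * x i, hxc]
  have e4 : 0 ≤ ∑ i, a (σ i) * ((μ i : ℝ) - x (σ i)) :=
    sum_mul_nonneg_of_partial_sums_nonneg hσ hy0 hyt
  have e5 : ∑ i, a (σ i) * (μ i : ℝ) ≤ ∑ i, a (σ i) * (ν i : ℝ) :=
    Finset.sum_le_sum fun i _ => e2 i
  have e6 : ∀ i, a (σ i) * (μ i : ℝ) = a (σ i) * ν i := fun i =>
    (Finset.sum_eq_sum_iff_of_le fun i _ => e2 i).1 (by linarith) i (mem_univ _)
  refine ⟨μ, hx, fun i hi => ?_, fun i hi => ?_, fun p q hpq hlt => ?_⟩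
  · have h1 := mul_left_cancel₀ hi.ne' (e6 i)
    have h2 : μ i = ν i := by exact_mod_cast h1
    rw [h2]
    exact if_pos hi
  · have h1 := mul_left_cancel₀ hi.ne (e6 i)
    have h2 : μ i = ν i := by exact_mod_cast h1
    rw [h2]
    exact if_neg (not_lt.2 hi.le)
  · have h1 := drop_mul_partial_sum_le hσ hy0 hyt hpq
    have h2 := hy0 (p.val + 1)
    have h3 : 0 < (a ∘ σ) p - (a ∘ σ) q := sub_pos.2 hlt
    have h4 : ∑ i, (a ∘ σ) i * ((μ i : ℝ) - x (σ i)) ≤ 0 := by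
      have : ∑ i, (a ∘ σ) i * ((μ i : ℝ) - x (σ i)) = ∑ i, a (σ i) * ((μ i : ℝ) - x (σ i)) := rfl
      linarith
    have h5 : ∑ i : Fin m with i.val < p.val + 1, ((μ i : ℝ) - x (σ i)) = 0 := by
      refine le_antisymm (not_lt.1 fun h6 => ?_) h2
      exact absurd (h1.trans h4) (not_le.2 (mul_pos h3 h6))
    rw [hy] at h5
    linarith

/-- The normal vectors of the facets of `Newt(G_{h, lam})`. -/
theorem exists_normal_of_isFacetIneq (hh : 1 ≤ h) (hlam : Antitone lam) (hne : lam ≠ 0)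
    {l : Fin m} (hl : lam l = 0) {a : Fin m → ℝ} {c : ℝ}
    (hf : IsFacetIneq (allWeights h lam) a c) :
    ∃ (t : ℝ) (a₀ : Fin m → ℝ), 0 < t ∧ a = t • a₀ ∧
      (a₀ = -indVec univ ∨ a₀ = indVec univ ∨
        ∃ I : Finset (Fin m), I.Nonempty ∧ I ≠ univ ∧ (a₀ = indVec I ∨ a₀ = -indVec Iᶜ)) := by
  obtain ⟨hval, -, ha0, hC⟩ :=
    (isFacetIneq_iff_of_constFun_eq_bot (constFun_allWeights hh hlam hne hl)).1 hf
  obtain ⟨σ, hσ⟩ := exists_perm_antitone_comp a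
  by_cases hconst : ∃ i j, (a ∘ σ) i ≠ (a ∘ σ) j
  · obtain ⟨p, q, hpq, hlt⟩ := exists_drop hσ hconst
    change a (σ q) < a (σ p) at hlt
    set I := initialLetters σ (p.val + 1) with hI
    have hpI : σ p ∈ I := apply_mem_initialLetters.2 (Nat.lt_succ_self _)
    have hqI : σ q ∉ I := fun hq => by have := apply_mem_initialLetters.1 hq; omega
    have hcard : I.card = p.val + 1 := by
      rw [hI, card_initialLetters, min_eq_right p.2]
    have of_mul : ∀ (v : Fin m → ℝ) (t : ℝ), 0 < t → v = t • a → a = t⁻¹ • v := by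
      rintro v t ht rfl
      rw [smul_smul, inv_mul_cancel₀ ht.ne', one_smul]
    have hIne : I ≠ univ := fun h1 => hqI (h1 ▸ mem_univ _)
    -- If `a` is positive before the drop, the first `p + 1` rows are full and the sum over `I` is
    -- constant on the face; otherwise `a` is negative after it, the later rows are those of `lam`,
    -- and the sum over `Iᶜ` is constant.
    by_cases hp : 0 < a (σ p)
    · have hmem : indVec I ∈ constFun (allWeights h lam ∩ {x | ∑ i, a i * x i = c}) := by
        refine mem_constFun_of_eq (c := headSum (topPart h lam) (p.val + 1)) fun x hx => ?_
        obtain ⟨μ, -, hpos, -, hdrop⟩ := exists_shape_of_mem_face hh hlam hval hσ hx.1 hx.2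
        rw [sum_indVec_mul, hdrop p q hpq hlt]
        congr 1
        refine headSum_congr fun i hi => hpos i (hp.trans_le ?_)
        exact hσ (Fin.le_def.2 (Nat.lt_succ_iff.1 hi))
      obtain ⟨t, ht⟩ := hC _ hmem
      have e := congrFun ht (σ p)
      simp only [indVec, if_pos hpI, Pi.smul_apply, smul_eq_mul] at e
      have ht0 : 0 < t := pos_of_mul_pos_left (by rw [← e]; exact one_pos) hp.le
      exact ⟨t⁻¹, indVec I, inv_pos.2 ht0, of_mul _ _ ht0 ht,
        Or.inr (Or.inr ⟨I, ⟨_, hpI⟩, hIne, Or.inl rfl⟩)⟩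
    · have hq : a (σ q) < 0 := hlt.trans_le (not_lt.1 hp)
      have hmem : -indVec Iᶜ ∈ constFun (allWeights h lam ∩ {x | ∑ i, a i * x i = c}) := by
        refine mem_constFun_of_eq (c := -(tailSum lam (p.val + 1) : ℝ)) fun x hx => ?_
        obtain ⟨μ, hxμ, -, hneg, hdrop⟩ := exists_shape_of_mem_face hh hlam hval hσ hx.1 hx.2
        have h1 := hdrop p q hpq hlt
        have h2 := sum_add_sum_compl_of_mem_weights hxμ I
        have h3 : tailSum μ (p.val + 1) = tailSum lam (p.val + 1) := by
          refine tailSum_congr fun i hi => hneg i (lt_of_le_of_lt ?_ hq)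
          exact hσ (Fin.le_def.2 (by omega))
        rw [hcard, h3] at h2
        rw [sum_neg_indVec_mul]
        linarith
      obtain ⟨t, ht⟩ := hC _ hmem
      have e := congrFun ht (σ q)
      simp only [indVec, Pi.neg_apply, if_pos (Finset.mem_compl.2 hqI), Pi.smul_apply,
        smul_eq_mul] at e
      have ht0 : 0 < t := by
        by_contra hcon
        have := mul_nonneg_of_nonpos_of_nonpos (not_lt.1 hcon) hq.le
        linarith
      exact ⟨t⁻¹, -indVec Iᶜ, inv_pos.2 ht0, of_mul _ _ ht0 ht,
        Or.inr (Or.inr ⟨I, ⟨_, hpI⟩, hIne, Or.inr rfl⟩)⟩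
  · push Not at hconst
    have hall : ∀ i, a i = a l := fun i => by
      simpa using hconst (σ.symm i) (σ.symm l)
    rcases lt_trichotomy (a l) 0 with hal | hal | hal
    · exact ⟨-a l, -indVec univ, neg_pos.2 hal, by funext i; simp [indVec, hall i], Or.inl rfl⟩
    · exact absurd (funext fun i => (hall i).trans hal) ha0
    · exact ⟨a l, indVec univ, hal, by funext i; simp [indVec, hall i], Or.inr (Or.inl rfl)⟩

end normals

end

/-! ### The classification of facets. -/

theorem mainTheorem10 (m h N : ℕ) (hh : 1 ≤ h) (lam : Fin m → ℕ)
    (hlam : Antitone lam)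
    (hred : ∀ i : Fin m, i.val + 1 = m → lam i = 0)
    (hne : lam ≠ 0)
    (hN : (inflatedGrothendieck h lam).totalDegree = (∑ i, lam i) + N)
    (a : Fin m → ℝ) (c : ℝ) :
    IsFacetIneq (newtonPolytope (inflatedGrothendieck h lam)) a c ↔
      ∃ (t : ℝ) (a₀ : Fin m → ℝ) (c₀ : ℝ), 0 < t ∧ a = t • a₀ ∧ c = t * c₀ ∧
        ( -- (a) the inequality `∑ x_i ≥ |lam|`
          (a₀ = -indVec univ ∧ c₀ = -((∑ i, lam i : ℕ) : ℝ)) ∨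
          -- (b) the inequality `∑ x_i ≤ |lam| + N`, if the orbit of `lam^(N)` is nontrivial
          ((∃ σ : Equiv.Perm (Fin m), domSeq h lam N ∘ σ ≠ domSeq h lam N) ∧
            a₀ = indVec univ ∧ c₀ = ((∑ i, lam i : ℕ) : ℝ) + N) ∨
          -- (c) the inequality `∑_{i ∈ I} x_i ≤ ∑_{i ≤ |I|} lam^(b_k)_i` with `|I| ≤ k`
          (∃ k ∈ Icc 1 m, ∃ I : Finset (Fin m), I.Nonempty ∧ I ≠ univ ∧ I.card ≤ k ∧
            a₀ = indVec I ∧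
            c₀ = (headSum (domSeq h lam (boxSum h lam N k)) I.card : ℝ) ∧
            IsFacetIneq (newtonPolytope (schurPoly (domSeq h lam (boxSum h lam N k)))) a₀ c₀) ∨
          -- (d) the inequality `∑_{i ∉ I} x_i ≥ ∑_{i > |I|} lam^(b_k)_i` with `|I| ≥ k`, `|I| ≠ 1`
          (∃ k ∈ Icc 1 m, ∃ I : Finset (Fin m), I.Nonempty ∧ I ≠ univ ∧ k ≤ I.card ∧ I.card ≠ 1 ∧
            a₀ = -indVec Iᶜ ∧
            c₀ = -(tailSum (domSeq h lam (boxSum h lam N k)) I.card : ℝ) ∧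
            IsFacetIneq (newtonPolytope (schurPoly (domSeq h lam (boxSum h lam N k)))) a₀ c₀)) := by
  have hm : 0 < m := by
    rcases Nat.eq_zero_or_pos m with rfl | hm
    · exact absurd (funext fun i => i.elim0) hne
    · exact hm
  obtain ⟨l, hlm⟩ : ∃ l : Fin m, l.val + 1 = m := ⟨⟨m - 1, by omega⟩, by simp only; omega⟩
  have hl := hred l hlm
  rw [totalDegree_inflatedGrothendieck hh hlam] at hN
  have hNr : ((∑ i, lam i : ℕ) : ℝ) + N = ((∑ i, topPart h lam i : ℕ) : ℝ) := by
    rw [hN, Nat.cast_add]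
  simp only [domSeq_boxSum hlam hN, domSeq_eq_topPart hlam hN, newtonPolytope_schurPoly,
    isFacetIneq_convexHull_iff, newtonPolytope_inflatedGrothendieck, hNr, exists_perm_comp_ne_iff]
  change IsFacetIneq (allWeights h lam) a c ↔ _
  constructor
  · intro hf
    obtain ⟨t, a₀, ht, rfl, hcases⟩ := exists_normal_of_isFacetIneq hh hlam hne hl hf
    have hf0 : IsFacetIneq (allWeights h lam) a₀ (t⁻¹ * c) := by
      have := hf.smul (inv_pos.2 ht)
      rwa [smul_smul, inv_mul_cancel₀ ht.ne', one_smul] at this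
    refine ⟨t, a₀, t⁻¹ * c, ht, rfl, (mul_inv_cancel_left₀ ht.ne' c).symm, ?_⟩
    generalize t⁻¹ * c = c₀ at hf0
    -- The normal determines the right-hand side as the maximum of the functional, through `eq_rhs`.
    rcases hcases with rfl | rfl | ⟨I, h1, h2, rfl | rfl⟩
    · have hA := isFacetIneq_neg_univ hh hlam hne hl
      exact Or.inl ⟨rfl, hf0.eq_rhs hA.1 hA.2.1⟩
    · obtain rfl := hf0.eq_rhs (fun x hx => sum_le_sum_topPart hh hx)
        (exists_sum_eq_sum_topPart hh hlam)
      exact Or.inr (Or.inl ⟨(isFacetIneq_univ_iff hh hlam hne hl).1 hf0, rfl, rfl⟩)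
    · obtain rfl := hf0.eq_rhs (fun x hx => sum_le_headSum_topPart hh I hx)
        (exists_sum_eq_headSum_topPart hh hlam I)
      obtain ⟨k, hk, hIk, hfk⟩ := exists_facet_midPart_of_head hh hlam hne hlm hl h1 h2 hf0
      have e := headSum_midPart (h := h) (lam := lam) hIk
      exact Or.inr (Or.inr (Or.inl ⟨k, hk, I, h1, h2, hIk, rfl, by rw [e], by rwa [e] at hfk⟩))
    · obtain rfl := hf0.eq_rhs (fun x hx => neg_sum_compl_le hh I hx)
        (exists_neg_sum_compl_eq hh hlam I)
      obtain ⟨hc, hfk⟩ := facet_of_tail hh hlam hne hlm hl h1 h2 hf0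
      -- For tails `k = 1` always suffices: the first row receives no boxes, so the shape is `lam`
      -- itself.
      refine Or.inr (Or.inr (Or.inr ⟨1, Finset.mem_Icc.2 ⟨le_rfl, hm⟩, I, h1, h2,
        Finset.card_pos.2 h1, hc, rfl, by rw [midPart_one], ?_⟩))
      rw [midPart_one]
      exact isFacetIneq_neg_indVec_compl_iff.2 hfk
  · rintro ⟨t, a₀, c₀, ht, rfl, rfl, hcases⟩
    refine IsFacetIneq.smul ht ?_
    rcases hcases with ⟨rfl, rfl⟩ | ⟨hne', rfl, rfl⟩ | ⟨k, -, I, h1, h2, hIk, rfl, rfl, hfk⟩ |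
      ⟨k, -, I, h1, h2, hIk, hc, rfl, rfl, hfk⟩
    · exact isFacetIneq_neg_univ hh hlam hne hl
    · exact (isFacetIneq_univ_iff hh hlam hne hl).2 hne'
    · have e := isFacetIneq_head_of_midPart hh hlam hne hlm hl h1 h2 hIk hfk
      rwa [headSum_midPart hIk]
    · rw [tailSum_midPart hIk]
      exact isFacetIneq_tail_of_midPart hh hlam hne hl h1 h2 hIk hc
        (isFacetIneq_neg_indVec_compl_iff.1 hfk)
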